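/- Let $d\ge 1$, let $\|\cdot\|$ be a norm on $\mathbb{R}^d$ and let $\alpha\in(0,\infty)$. Let $(X_t)_{t\in\mathbb{Z}}$ be a stationary process in $\mathbb{R}^d$ that is jointly regularly varying of index $\alpha$ (that is, for every $k\ge 1$ the law of the $kd$-dimensional vector $(X_1,\dots,X_k)$ is regularly varying of index $\alpha$), and let $(Y_t)_{t\in\mathbb{Z}}$ be its tail process: $\Pr(\|Y_0\|>y)=y^{-\alpha}$ for $y\ge 1$, and for all integers $s\le t$, \[ \mathcal{L}\bigl(x^{-1}X_s,\dots,x^{-1}X_t \,\big|\, \|X_0\|>x\bigr)\rightsquigarrow \mathcal{L}(Y_s,\dots,Y_t),\qquad x\to\infty . \] Write $M_r=\max_{1\le i\le r}\|X_i\|$, and let $(a_n)$ be a positive sequence with $n\Pr(\|X_0\|>a_n)\to 1$. Let $(r_n)$ be a sequence of positive integers with $r_n\to\infty$ and $r_n/n\to 0$ that satisfies the finite-cluster condition: for every $u\in(0,\infty)$, \[ \lim_{m\to\infty}\limsup_{n\to\infty}\Pr\Bigl(\max_{m\le|t|\le r_n}\|X_t\|>a_nu \,\Big|\, \|X_0\|>a_nu\Bigr)=0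 . \] Define the candidate extremal index \[ \theta=\lim_{r\to\infty}\lim_{x\to\infty}\Pr(M_r\le x\mid\|X_0\|>x)=\lim_{r\to\infty}\Pr\Bigl(\max_{1\le i\le r}\|Y_i\|\le 1\Bigr)=\Pr\Bigl(\sup_{i\ge1}\|Y_i\|\le 1\Bigr) \] (the limits exist and the equalities hold), and let \[ E=\Bigl\{\sup_{t<0}\|Y_t\|<\|Y_0\|=\sup_{t\in\mathbb{Z}}\|Y_t\|\Bigr\} \] be the event that the supremum of $(\|Y_t\|)$ is attained for the first time at $t=0$. Then: 1. $\Pr\bigl(\lim_{|t|\to\infty}\|Y_t\|=0\bigr)=1$. In particular, $\sum_{t\in\mathbb{Z}}\delta_{Y_t}$ is almost surely a Radon point measure on $\mathbb{E}=[-\infty,\infty]^d\setminus\{0\}$ (points equal to $0$ are not counted). 2. $\theta=\Pr(E)>0$. 3. For every $u\in(0,\infty)$, as $n\to\infty$, \[ \Pr(M_{r_n}\le a_nu\mid\|X_0\|>a_nu)=\frac{\Pr(M_{r_n}>a_nu)}{r_n\Pr(\|X_0\|>a_nu)}+o(1)\to\theta . \] 4. For every $u\in(0,\infty)$, as $n\to\infty$,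 the law of $\sum_{i=1}^{r_n}\delta_{X_i/(a_nu)}$ conditionally on $M_{r_n}>a_nu$ converges weakly, in the space of point measures on $\mathbb{E}$ with the vague topology, to the law of $\sum_{t\in\mathbb{Z}}\delta_{Y_t}$ conditionally on $E$. -/

import Mathlib

open MeasureTheory ProbabilityTheory Filter Topology Set
open scoped NNReal ENNReal BoundedContinuousFunction CompactlySupported

noncomputable section

/-! ### Norms, weak convergence, regular variation -/

/-- A seminorm that is a norm. -/
def IsNorm {V : Type*} [AddCommGroup V] [Module ℝ V] (N : Seminorm ℝ V) : Prop :=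
  ∀ x, N x = 0 → x = 0

/-- Weak convergence of a family of finite measures along a filter: convergence of the
integrals of all bounded continuous functions. -/
def WeakConv {S ι : Type*} [TopologicalSpace S] [MeasurableSpace S]
    (μ : ι → Measure S) (l : Filter ι) (ν : Measure S) : Prop :=
  ∀ F : S →ᵇ ℝ, Tendsto (fun i => ∫ z, F z ∂(μ i)) l (𝓝 (∫ z, F z ∂ν))

/-- The law of the random vector `W` is regularly varying of index `α`: for some norm `N` there is a
probability measure `σ` (the spectral measure) on the unit sphere of `N` such that, for all `u > 0`,
`P(N(W) > u x, W / N(W) ∈ ·) / P(N(W) > x)` converges weakly to `u ^ (-α) σ` as `x → ∞`. -/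
def IsRegularlyVaryingVector {Ω V : Type*} [MeasurableSpace Ω] [AddCommGroup V] [Module ℝ V]
    [TopologicalSpace V] [MeasurableSpace V] (P : Measure Ω) (α : ℝ) (W : Ω → V) : Prop :=
  ∃ N : Seminorm ℝ V, IsNorm N ∧ ∃ σ : Measure V, IsProbabilityMeasure σ ∧
    σ {z | N z = 1} = 1 ∧
    ∀ u : ℝ, 0 < u →
      WeakConv
        (fun x : ℝ => (P {ω | x < N (W ω)})⁻¹ •
          (P.restrict {ω | u * x < N (W ω)}).map (fun ω => (N (W ω))⁻¹ • W ω))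
        atTop (ENNReal.ofReal (u ^ (-α)) • σ)

/-- `ℝ^d`, with the product topology and Borel σ-algebra; norms on it are given explicitly. -/
abbrev Vec (d : ℕ) : Type := Fin d → ℝ

/-- (Strict) stationarity: the law of the whole path is invariant under time shifts. -/
def IsStationaryProcess {Ω : Type*} [MeasurableSpace Ω] {d : ℕ} (P : Measure Ω)
    (X : ℤ → Ω → Vec d) : Prop :=
  ∀ h : ℤ, P.map (fun ω (t : ℤ) => X (t + h) ω) = P.map (fun ω (t : ℤ) => X t ω)

/-- Joint regular variation of index `α`: for all `k ≥ 1` the `kd`-dimensional vector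
`(X_1, …, X_k)` is regularly varying of index `α`. -/
def IsJointlyRegularlyVarying {Ω : Type*} [MeasurableSpace Ω] {d : ℕ} (P : Measure Ω) (α : ℝ)
    (X : ℤ → Ω → Vec d) : Prop :=
  ∀ k : ℕ, 0 < k →
    IsRegularlyVaryingVector P α (fun ω (i : Fin k) => X ((i : ℤ) + 1) ω)

/-- `Y` (a process under `Q`) is the tail process of `X` (a process under `P`) for the norm `N`:
`Q(N(Y_0) > y) = y ^ (-α)` for `y ≥ 1`, and for all `s ≤ t` the law of
`(X_s / x, …, X_t / x)` given `N(X_0) > x` converges weakly to that of `(Y_s, …, Y_t)`. -/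
def IsTailProcess {Ω Ω' : Type*} [MeasurableSpace Ω] [MeasurableSpace Ω'] {d : ℕ}
    (N : Seminorm ℝ (Vec d)) (α : ℝ) (P : Measure Ω) (X : ℤ → Ω → Vec d)
    (Q : Measure Ω') (Y : ℤ → Ω' → Vec d) : Prop :=
  (∀ y : ℝ, 1 ≤ y → Q.real {ω | y < N (Y 0 ω)} = y ^ (-α)) ∧
  ∀ s t : ℤ, s ≤ t →
    WeakConv
      (fun x : ℝ => (P[|{ω | x < N (X 0 ω)}]).map
        (fun ω (i : Set.Icc s t) => x⁻¹ • X i ω))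
      atTop (Q.map (fun ω (i : Set.Icc s t) => Y i ω))

/-! ### Maxima, the candidate extremal index, the finite-cluster condition -/

/-- `max_{t ∈ s} N(x_t)` over a finite set `s` of times (`0` if `s` is empty). -/
def maxNorm {d : ℕ} (N : Seminorm ℝ (Vec d)) (s : Finset ℤ) (x : ℤ → Vec d) : ℝ :=
  ((s.sup fun t => (N (x t)).toNNReal : ℝ≥0) : ℝ)

/-- `M_r = max_{1 ≤ i ≤ r} N(X_i)`. -/
def runMax {Ω : Type*} {d : ℕ} (N : Seminorm ℝ (Vec d)) (X : ℤ → Ω → Vec d) (r : ℕ) (ω : Ω) : ℝ :=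
  maxNorm N (Finset.Icc 1 (r : ℤ)) (fun t => X t ω)

/-- `sup_{t ∈ s} N(x_t) ∈ [0, ∞]` over an arbitrary set `s` of times. -/
def supNorm {d : ℕ} (N : Seminorm ℝ (Vec d)) (s : Set ℤ) (x : ℤ → Vec d) : ℝ≥0∞ :=
  ⨆ t ∈ s, ENNReal.ofReal (N (x t))

/-- The candidate extremal index `θ = Q(sup_{i ≥ 1} N(Y_i) ≤ 1)`. -/
def candidateExtremalIndex {Ω' : Type*} [MeasurableSpace Ω'] {d : ℕ} (N : Seminorm ℝ (Vec d))
    (Q : Measure Ω') (Y : ℤ → Ω' → Vec d) : ℝ :=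
  Q.real {ω | supNorm N (Set.Ici 1) (fun t => Y t ω) ≤ 1}

/-- The event that the supremum of `(N(Y_t))` is attained for the first time at `t = 0`:
`sup_{t < 0} N(Y_t) < N(Y_0) = sup_t N(Y_t)`. -/
def firstMaxAtZero {Ω' : Type*} {d : ℕ} (N : Seminorm ℝ (Vec d)) (Y : ℤ → Ω' → Vec d) : Set Ω' :=
  {ω | supNorm N (Set.Iio 0) (fun t => Y t ω) < ENNReal.ofReal (N (Y 0 ω)) ∧
    ENNReal.ofReal (N (Y 0 ω)) = supNorm N Set.univ (fun t => Y t ω)}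

/-- The finite-cluster condition, for the normalizing sequence `a` and a given sequence `r`. -/
def FiniteCluster {Ω : Type*} [MeasurableSpace Ω] {d : ℕ} (N : Seminorm ℝ (Vec d)) (P : Measure Ω)
    (X : ℤ → Ω → Vec d) (a : ℕ → ℝ) (r : ℕ → ℕ) : Prop :=
  (∀ n, 0 < r n) ∧ Tendsto r atTop atTop ∧
  Tendsto (fun n : ℕ => (r n : ℝ) / (n : ℝ)) atTop (𝓝 0) ∧
  ∀ u : ℝ, 0 < u →
    Tendsto
      (fun m : ℕ => limsup
        (fun n : ℕ => (P[|{ω | a n * u < N (X 0 ω)}])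
          {ω | a n * u < maxNorm N
            ((Finset.Icc (-(r n : ℤ)) (r n : ℤ)).filter fun t => (m : ℤ) ≤ |t|)
            (fun t => X t ω)})
        atTop)
      atTop (𝓝 0)

/-! ### Point processes on `[-∞, ∞]^d \ {0}` -/

/-- The state space `[-∞, ∞]^d \ {0}`. -/
abbrev StateSpace (d : ℕ) : Type := {z : Fin d → EReal // z ≠ 0}

/-- The point measures on the state space: Radon measures with values in `{0, 1, 2, …, ∞}`. -/
structure PointMeasure (d : ℕ) where
  toMeasure : Measure (StateSpace d)
  finite_on_compacts : ∀ K : Set (StateSpace d), IsCompact K → toMeasure K < ∞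
  integer_valued : ∀ B : Set (StateSpace d), MeasurableSet B →
    ∃ k : ℕ∞, toMeasure B = (k : ℝ≥0∞)

/-- The vague topology: the coarsest topology that makes `μ ↦ ∫ f dμ` continuous for every
nonnegative continuous function `f` with compact support. -/
instance (d : ℕ) : TopologicalSpace (PointMeasure d) :=
  TopologicalSpace.induced
    (fun μ (f : C_c(StateSpace d, ℝ≥0)) => ∫⁻ z, (f z : ℝ≥0∞) ∂μ.toMeasure) inferInstance

/-- The Borel σ-algebra of the vague topology. -/
instance (d : ℕ) : MeasurableSpace (PointMeasure d) := borel _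

instance (d : ℕ) : BorelSpace (PointMeasure d) := ⟨rfl⟩

open Classical in
/-- The unit mass `δ_x` on the state space; the origin is not a point of the state space, so
`δ_0` contributes nothing. -/
def atom {d : ℕ} (x : Vec d) : Measure (StateSpace d) :=
  if h : (fun j => (x j : EReal)) ≠ 0 then Measure.dirac ⟨fun j => (x j : EReal), h⟩ else 0

/-- `∑_i δ_{x_i}` as a measure on the state space. -/
def atomSum {ι : Type*} {d : ℕ} (x : ι → Vec d) : Measure (StateSpace d) :=
  Measure.sum fun i => atom (x i)

open Classical in
/-- A measure, seen as a point measure; measures that are not point measures are sent to `0`. -/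
def toPointMeasure {d : ℕ} (μ : Measure (StateSpace d)) : PointMeasure d :=
  if h : ∃ ν : PointMeasure d, ν.toMeasure = μ then h.choose else
    ⟨0, fun _ _ => by simp, fun _ _ => ⟨0, by simp⟩⟩

/-- The point process `∑_{i=1}^r δ_{X_i / c}`. -/
def clusterProcess {Ω : Type*} {d : ℕ} (X : ℤ → Ω → Vec d) (r : ℕ) (c : ℝ) (ω : Ω) :
    PointMeasure d :=
  toPointMeasure (atomSum fun i : Set.Icc (1 : ℤ) r => c⁻¹ • X i ω)

/-- The point process `∑_{t ∈ ℤ} δ_{Y_t}` (meaningful where this sum is a Radon measure). -/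
def tailPointProcess {Ω' : Type*} {d : ℕ} (Y : ℤ → Ω' → Vec d) (ω : Ω') : PointMeasure d :=
  toPointMeasure (atomSum fun t : ℤ => Y t ω)

end

open scoped ZeroAtInfty

noncomputable section

/-! ### Weak convergence: approximation, continuity sets, products -/

/-! Everything takes place on path space, with `ν` the law of `X` and `μ` the law of `Y`
(`IsTailPair`). Convergence on finite windows gives weak convergence of the rescaled path in the
product topology. Since `N (Y t)` has no atoms in `(0, ∞)` (`measure_norm_eq`), exceedance events
over finitely many times pass to the limit. Stationarity then gives the formula `time_change`, whose
two sides are limits of one and the same quantity.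

The identities between the limits come from anchoring (`IsAnchor`). When `Y` vanishes at infinity, a
path has exactly one first exceedance of level `1`, one last exceedance and one first maximum.
Summing the time-change formula over the lag between the times selected by two such rules shows that
a shift-invariant event has the same probability together with "time `0` is selected", whichever the
rule (`measure_inter_eq`). The probability that `0` is selected is positive, since otherwise no time
would ever be selected (`IsAnchor.measure_pos`). So the three rules share one value, `θ = Q(E) > 0`.

The finite-cluster condition says that an exceedance is rarely accompanied by large values at
distance at least `m`, uniformly over the block. In the limit this makes `Y` vanish at infinity
(`ae_tendsto_norm`). It also lets the runs estimator be computed on a fixed window; its limit is the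
last-exceedance probability (`tendsto_runs`). For blocks, `{M_r > x}` is split according to the
first exceedance `i`, and `i` is shifted to `0`. All but `2m` positions see the whole window `[-m,
m]` and contribute nearly the same amount, so the average over `i` converges to an integral over
paths whose first exceedance is at `0` (`tendsto_sum_blockIntegral`). The test function `1` gives
the blocks estimator; general test functions give convergence in law of the recentred block in `C₀`.
The point measure of a path depends continuously on it in `C₀` and ignores shifts, so the recentring
disappears and the first-exceedance event may be traded for `E` (`tendsto_cluster`). -/

theorem tendsto_of_uniform_approx {ι : Type*} {l : Filter ι} {f : ι → ℝ} {c : ℝ}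
    {g : ℕ → ι → ℝ} {b : ℕ → ℝ} (hg : ∀ k, Tendsto (g k) l (𝓝 (b k)))
    (hb : Tendsto b atTop (𝓝 c))
    (happ : ∀ ε : ℝ, 0 < ε → ∀ᶠ k in atTop, ∀ᶠ i in l, |f i - g k i| ≤ ε) :
    Tendsto f l (𝓝 c) := by
  rw [Metric.tendsto_nhds]
  intro ε hε
  have h1 := happ (ε / 4) (by positivity)
  have h2 := Metric.tendsto_nhds.1 hb (ε / 4) (by positivity)
  obtain ⟨k, hk1, hk2⟩ := (h1.and h2).exists
  filter_upwards [hk1, Metric.tendsto_nhds.1 (hg k) (ε / 4) (by positivity)] with i hi1 hi2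
  rw [Real.dist_eq] at *
  have := abs_add_three (f i - g k i) (g k i - b k) (b k - c)
  have e : f i - g k i + (g k i - b k) + (b k - c) = f i - c := by ring
  rw [e] at this
  linarith

theorem cond_map {α β : Type*} [MeasurableSpace α] [MeasurableSpace β] (μ : Measure α)
    {g : α → β} (hg : Measurable g) {B : Set β} (hB : MeasurableSet B) :
    (μ.map g)[|B] = (μ[|g ⁻¹' B]).map g := by
  simp only [ProbabilityTheory.cond]
  rw [Measure.map_smul, Measure.restrict_map hg hB, Measure.map_apply hg hB]

theorem integral_cond {α : Type*} [MeasurableSpace α] (μ : Measure α) (B : Set α) (f : α → ℝ) :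
    ∫ z, f z ∂(μ[|B]) = (∫ z in B, f z ∂μ) / μ.real B := by
  simp only [ProbabilityTheory.cond]
  rw [integral_smul_measure, ENNReal.toReal_inv, smul_eq_mul, div_eq_inv_mul]
  rfl

/-- The integrand, cut off by `A`, is multiplied by a factor vanishing on the frontier of `A`, which
makes it continuous. The error is at most `‖h‖` times the mass of a shrinking neighbourhood of the
frontier, and this is small in the limit. -/
theorem tendsto_setIntegral_of_null_frontier {S ι : Type*} [MeasurableSpace S]
    [PseudoEMetricSpace S] [OpensMeasurableSpace S] {l : Filter ι}
    {μs : ι → ProbabilityMeasure S} {μ : ProbabilityMeasure S} (hμ : Tendsto μs l (𝓝 μ))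
    {A : Set S} (hA : MeasurableSet A) (hfr : (μ : Measure S) (frontier A) = 0) (h : S →ᵇ ℝ) :
    Tendsto (fun i => ∫ z in A, h z ∂(μs i : Measure S)) l
      (𝓝 (∫ z in A, h z ∂(μ : Measure S))) := by
  set δ : ℕ → ℝ := fun n => 1 / ((n : ℝ) + 1)
  have δpos : ∀ n, 0 < δ n := fun n => by positivity
  let ψ : ℕ → S → ℝ := fun n z => (thickenedIndicator (δpos n) (frontier A) z : ℝ)
  have ψcont : ∀ n, Continuous (ψ n) := fun n =>
    NNReal.continuous_coe.comp (thickenedIndicator (δpos n) (frontier A)).continuous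
  have ψ0 : ∀ n z, 0 ≤ ψ n z := fun n z => NNReal.coe_nonneg _
  have ψ1 : ∀ n z, ψ n z ≤ 1 := fun n z => by
    exact_mod_cast thickenedIndicator_le_one (δpos n) (frontier A) z
  have ψfr : ∀ n, ∀ z ∈ frontier A, ψ n z = 1 := fun n z hz => by
    simp only [ψ, thickenedIndicator_one (δpos n) (frontier A) hz, NNReal.coe_one]
  have hψ : Tendsto (fun n => ∫ z, ψ n z ∂(μ : Measure S)) atTop (𝓝 0) := by
    have := tendsto_integral_thickenedIndicator_of_isClosed (μ : Measure S)
      (isClosed_frontier (s := A)) δpos tendsto_one_div_add_atTop_nhds_zero_nat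
    rwa [Measure.real, hfr, ENNReal.toReal_zero] at this
  have hint : ∀ (ρ : ProbabilityMeasure S) (φ : S → ℝ), Continuous φ → (∃ C, ∀ z, |φ z| ≤ C) →
      Integrable φ (ρ : Measure S) := fun ρ φ hφ ⟨C, hC⟩ =>
    Integrable.of_bound hφ.measurable.aestronglyMeasurable C (Eventually.of_forall hC)
  have hb : ∀ z, |h z| ≤ ‖h‖ := fun z => h.norm_coe_le_norm z
  let φ : ℕ → S → ℝ := fun n => A.indicator fun z => h z * (1 - ψ n z)
  have φcont : ∀ n, Continuous (φ n) := fun n =>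
    continuous_indicator (fun z hz => by simp [ψfr n z hz])
      (h.continuous.mul (continuous_const.sub (ψcont n))).continuousOn
  have φb : ∀ n z, |φ n z| ≤ ‖h‖ := fun n z => by
    by_cases hz : z ∈ A
    · simp only [φ, indicator_of_mem hz, abs_mul]
      have : |1 - ψ n z| ≤ 1 := by rw [abs_le]; constructor <;> linarith [ψ0 n z, ψ1 n z]
      calc |h z| * |1 - ψ n z| ≤ ‖h‖ * 1 := by gcongr; exact hb z
        _ = _ := mul_one _
    · simp [φ, indicator_of_notMem hz]
  have conv : ∀ g : S → ℝ, Continuous g → (∃ C, ∀ z, |g z| ≤ C) →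
      Tendsto (fun i => ∫ z, g z ∂(μs i : Measure S)) l (𝓝 (∫ z, g z ∂(μ : Measure S))) := by
    rintro g hg ⟨C, hC⟩
    exact ProbabilityMeasure.tendsto_iff_forall_integral_tendsto.1 hμ
      (BoundedContinuousFunction.ofNormedAddCommGroup g hg C hC)
  have key : ∀ (ρ : ProbabilityMeasure S) n,
      |∫ z in A, h z ∂(ρ : Measure S) - ∫ z, φ n z ∂(ρ : Measure S)|
        ≤ ‖h‖ * ∫ z, ψ n z ∂(ρ : Measure S) := by
    intro ρ n
    have i1 : Integrable (fun z => A.indicator h z) (ρ : Measure S) :=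
      (hint ρ h h.continuous ⟨‖h‖, hb⟩).indicator hA
    have i2 := hint ρ (φ n) (φcont n) ⟨_, φb n⟩
    rw [← integral_indicator hA, ← integral_sub i1 i2, ← integral_const_mul]
    refine (abs_integral_le_integral_abs).trans
      (integral_mono (i1.sub i2).abs
        ((hint ρ (ψ n) (ψcont n) ⟨1, fun z => by
          rw [abs_of_nonneg (ψ0 n z)]; exact ψ1 n z⟩).const_mul _) fun z => ?_)
    by_cases hz : z ∈ A
    · simp only [φ, indicator_of_mem hz]
      have : h z - h z * (1 - ψ n z) = h z * ψ n z := by ring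
      rw [this, abs_mul, abs_of_nonneg (ψ0 n z)]
      exact mul_le_mul_of_nonneg_right (hb z) (ψ0 n z)
    · simp only [φ, indicator_of_notMem hz, sub_self, abs_zero]
      exact mul_nonneg (norm_nonneg _) (ψ0 n z)
  have hψ' : Tendsto (fun n => ‖h‖ * ∫ z, ψ n z ∂(μ : Measure S)) atTop (𝓝 0) := by
    simpa using hψ.const_mul ‖h‖
  refine tendsto_of_uniform_approx (g := fun n i => ∫ z, φ n z ∂(μs i : Measure S))
    (b := fun n => ∫ z, φ n z ∂(μ : Measure S)) (fun n => conv _ (φcont n) ⟨_, φb n⟩) ?_ ?_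
  · rw [tendsto_iff_dist_tendsto_zero]
    refine squeeze_zero (fun _ => dist_nonneg) (fun n => ?_) hψ'
    rw [dist_comm, Real.dist_eq]
    exact key μ n
  · intro ε hε
    filter_upwards [hψ'.eventually_lt_const hε] with n hn
    have := (conv (ψ n) (ψcont n) ⟨1, fun z => by
      rw [abs_of_nonneg (ψ0 n z)]; exact ψ1 n z⟩).const_mul ‖h‖
    filter_upwards [this.eventually_lt_const hn] with i hi
    exact (key _ n).trans hi.le

/-- The space of paths `ℤ → ℝ^d`, with the product topology. -/
abbrev PathSpace (d : ℕ) : Type := ℤ → Vec d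

/-- Extension by `0` of a path defined on a finite window. -/
def extendWindow {d : ℕ} (s t : ℤ) (w : Set.Icc s t → Vec d) : PathSpace d :=
  fun i => if h : i ∈ Set.Icc s t then w ⟨i, h⟩ else 0

theorem continuous_extendWindow {d : ℕ} (s t : ℤ) :
    Continuous (extendWindow (d := d) s t) := by
  refine continuous_pi fun i => ?_
  by_cases h : i ∈ Set.Icc s t
  · simpa [extendWindow, h] using! continuous_apply (⟨i, h⟩ : Set.Icc s t)
  · simpa [extendWindow, h] using! continuous_const

open scoped PiCountable in
-- The product distance is a sum over times whose terms are dominated by a summable geometric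
-- sequence, so the times outside a large window contribute at most `ε` whatever the path.
theorem exists_dist_extendWindow_le (d : ℕ) {ε : ℝ} (hε : 0 < ε) : ∃ m₀ : ℕ, ∀ m ≥ m₀,
    ∀ y : PathSpace d, dist y (extendWindow (-(m : ℤ)) m fun i => y i) ≤ ε := by
  let f : ℤ → ℝ := fun i => 2⁻¹ ^ Encodable.encode i
  have hf : Summable f := by simpa [f, one_div] using summable_geometric_two_encode (ι := ℤ)
  obtain ⟨T, hT⟩ := ((tendsto_tsum_compl_atTop_zero f).eventually_lt_const hε).exists
  refine ⟨T.sup Int.natAbs, fun m hm y => ?_⟩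
  set z := extendWindow (-(m : ℤ)) m fun i => y i
  have hz : ∀ i ∈ T, z i = y i := fun i hi => by
    have : i.natAbs ≤ m := (Finset.le_sup (f := Int.natAbs) hi).trans hm
    have : i ∈ Set.Icc (-(m : ℤ)) m := ⟨by omega, by omega⟩
    simp only [z, extendWindow, this, dif_pos]
  rw [PiCountable.dist_eq_tsum]
  have hs := PiCountable.dist_summable y z
  rw [← hs.sum_add_tsum_subtype_compl T, Finset.sum_eq_zero, zero_add]
  · refine (Summable.tsum_le_tsum (fun i => min_le_left _ _) (hs.subtype _)
      (hf.subtype _)).trans hT.le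
  · intro i hi
    simp [hz i hi]

open scoped PiCountable in
/-- Convergence of the laws of all finite windows implies weak convergence in path space. -/
theorem tendsto_path_of_windows {d : ℕ} {ι : Type*} {l : Filter ι} [l.IsCountablyGenerated]
    {μs : ι → ProbabilityMeasure (PathSpace d)} {μ : ProbabilityMeasure (PathSpace d)}
    (h : ∀ m : ℕ, WeakConv
      (fun i => (μs i : Measure (PathSpace d)).map fun y (j : Set.Icc (-(m : ℤ)) m) => y j) l
      ((μ : Measure (PathSpace d)).map fun y (j : Set.Icc (-(m : ℤ)) m) => y j)) :
    Tendsto μs l (𝓝 μ) := by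
  rw [tendsto_iff_forall_lipschitz_integral_tendsto]
  rintro f ⟨C, hC⟩ ⟨L, hL⟩
  have hfb : ∀ y, |f y| ≤ C + |f 0| := fun y => by
    have := hC y 0
    rw [Real.dist_eq] at this
    have e : f y = (f y - f 0) + f 0 := by ring
    rw [e]
    exact (abs_add_le _ _).trans (by linarith)
  have hcont := hL.continuous
  let g : ℕ → PathSpace d → ℝ := fun m y => f (extendWindow (-(m : ℤ)) m fun i => y i)
  have hg : ∀ m, Continuous (g m) := fun m =>
    hcont.comp ((continuous_extendWindow _ _).comp (by fun_prop))
  have hint : ∀ (ρ : ProbabilityMeasure (PathSpace d)) (φ : PathSpace d → ℝ), Continuous φ →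
      (∀ z, |φ z| ≤ C + |f 0|) → Integrable φ (ρ : Measure (PathSpace d)) := fun ρ φ hφ hC =>
    Integrable.of_bound hφ.measurable.aestronglyMeasurable _ (Eventually.of_forall hC)
  have key : ∀ ε : ℝ, 0 < ε → ∃ m₀ : ℕ, ∀ m ≥ m₀, ∀ ρ : ProbabilityMeasure (PathSpace d),
      |∫ y, f y ∂(ρ : Measure (PathSpace d)) - ∫ y, g m y ∂(ρ : Measure (PathSpace d))| ≤ ε := by
    intro ε hε
    -- Dividing by `L + 1` rather than by `L` covers the case `L = 0`.
    obtain ⟨m₀, hm₀⟩ := exists_dist_extendWindow_le d (ε := ε / (L + 1)) (by positivity)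
    refine ⟨m₀, fun m hm ρ => ?_⟩
    have i1 := hint ρ f hcont hfb
    have i2 := hint ρ (g m) (hg m) fun y => hfb _
    rw [← integral_sub i1 i2]
    have := norm_integral_le_of_norm_le_const (μ := (ρ : Measure (PathSpace d))) (C := ε)
      (f := fun y => f y - g m y) (Eventually.of_forall fun y => ?_)
    · simpa using this
    · rw [Real.norm_eq_abs, ← Real.dist_eq]
      refine (hL.dist_le_mul _ _).trans ?_
      calc (L : ℝ) * dist y (extendWindow (-(m : ℤ)) m fun i => y i)
          ≤ (L + 1) * (ε / (L + 1)) := by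
            gcongr
            · linarith
            · exact hm₀ m hm y
        _ = ε := by field_simp
  refine tendsto_of_uniform_approx (g := fun m i => ∫ y, g m y ∂(μs i : Measure (PathSpace d)))
    (b := fun m => ∫ y, g m y ∂(μ : Measure (PathSpace d))) (fun m => ?_) ?_ ?_
  · have hc : Continuous fun w => f (extendWindow (d := d) (-(m : ℤ)) m w) :=
      hcont.comp (continuous_extendWindow _ _)
    have := h m (BoundedContinuousFunction.ofNormedAddCommGroup
      (fun w => f (extendWindow (-(m : ℤ)) m w)) hc (C + |f 0|) (fun w => hfb _))
    have e : ∀ ρ : Measure (PathSpace d),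
        ∫ w, f (extendWindow (-(m : ℤ)) m w)
          ∂(ρ.map fun y (j : Set.Icc (-(m : ℤ)) m) => y j) = ∫ y, g m y ∂ρ := fun ρ =>
      integral_map (measurable_pi_lambda _ fun j => measurable_pi_apply _).aemeasurable
        hc.measurable.aestronglyMeasurable
    simpa only [BoundedContinuousFunction.coe_ofNormedAddCommGroup, e] using this
  · rw [Metric.tendsto_atTop]
    intro ε hε
    obtain ⟨m₀, hm₀⟩ := key (ε / 2) (by positivity)
    refine ⟨m₀, fun m hm => ?_⟩
    rw [dist_comm, Real.dist_eq]
    linarith [hm₀ m hm μ]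
  · intro ε hε
    obtain ⟨m₀, hm₀⟩ := key ε hε
    filter_upwards [eventually_ge_atTop m₀] with m hm
    exact Eventually.of_forall fun i => hm₀ m hm _

/-! ### The tail process in path space -/

theorem Seminorm.continuous_vec {d : ℕ} (N : Seminorm ℝ (Vec d)) : Continuous N :=
  N.convexOn.locallyLipschitz.continuous

/-- By compactness `N` has a positive minimum on the unit sphere of the sup norm. That sphere is
empty when `d = 0`, hence the case distinction. -/
theorem IsNorm.exists_norm_le {d : ℕ} {N : Seminorm ℝ (Vec d)} (hN : IsNorm N) :
    ∃ C : ℝ, 0 < C ∧ ∀ v, ‖v‖ ≤ C * N v := by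
  have hc : IsCompact (Metric.sphere (0 : Vec d) 1) := isCompact_sphere _ _
  rcases (Metric.sphere (0 : Vec d) 1).eq_empty_or_nonempty with he | hne
  · refine ⟨1, one_pos, fun v => ?_⟩
    by_cases hv : v = 0
    · simp [hv]
    · have : (‖v‖⁻¹ • v) ∈ Metric.sphere (0 : Vec d) 1 := by
        simp [norm_smul, norm_ne_zero_iff.2 hv]
      simp [he] at this
  · obtain ⟨w, hw, hmin⟩ := hc.exists_isMinOn hne N.continuous_vec.continuousOn
    have hw0 : w ≠ 0 := by
      rintro rfl
      simp at hw
    have hpos : 0 < N w := (apply_nonneg N w).lt_of_ne fun h => hw0 (hN w h.symm)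
    refine ⟨(N w)⁻¹, inv_pos.2 hpos, fun v => ?_⟩
    by_cases hv : v = 0
    · simp [hv]
    have hv' : 0 < ‖v‖ := norm_pos_iff.2 hv
    have : (‖v‖⁻¹ • v) ∈ Metric.sphere (0 : Vec d) 1 := by
      simp [norm_smul, norm_ne_zero_iff.2 hv]
    have h2 : N w ≤ N (‖v‖⁻¹ • v) := hmin this
    rw [map_smul_eq_mul, Real.norm_eq_abs, abs_of_pos (inv_pos.2 hv')] at h2
    rw [inv_mul_eq_div, le_div_iff₀ hpos]
    calc ‖v‖ * N w ≤ ‖v‖ * (‖v‖⁻¹ * N v) := by gcongr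
      _ = N v := by field_simp

theorem seminorm_inv_smul {d : ℕ} (N : Seminorm ℝ (Vec d)) {x : ℝ} (hx : 0 < x) (v : Vec d) :
    N (x⁻¹ • v) = N v / x := by
  rw [map_smul_eq_mul, Real.norm_eq_abs, abs_of_pos (inv_pos.2 hx), inv_mul_eq_div]

/-- The time shift on path space. -/
def shiftPath {d : ℕ} (h : ℤ) (y : PathSpace d) : PathSpace d := fun t => y (t + h)

@[simp] theorem shiftPath_apply {d : ℕ} (h : ℤ) (y : PathSpace d) (t : ℤ) :
    shiftPath h y t = y (t + h) := rfl

theorem continuous_shiftPath {d : ℕ} (h : ℤ) : Continuous (shiftPath (d := d) h) := by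
  unfold shiftPath
  fun_prop

theorem measurable_shiftPath {d : ℕ} (h : ℤ) : Measurable (shiftPath (d := d) h) :=
  (continuous_shiftPath h).measurable

theorem shiftPath_shiftPath {d : ℕ} (h k : ℤ) (y : PathSpace d) :
    shiftPath h (shiftPath k y) = shiftPath (h + k) y := by
  funext t
  simp [add_assoc]

@[simp] theorem shiftPath_zero {d : ℕ} (y : PathSpace d) : shiftPath 0 y = y := by
  funext t
  simp

/-- The paths whose value at time `0` has norm larger than `x`. -/
def exceed {d : ℕ} (N : Seminorm ℝ (Vec d)) (x : ℝ) : Set (PathSpace d) := {y | x < N (y 0)}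

theorem measurable_seminorm_apply {d : ℕ} (N : Seminorm ℝ (Vec d)) (t : ℤ) :
    Measurable fun y : PathSpace d => N (y t) :=
  N.continuous_vec.measurable.comp (measurable_pi_apply t)

theorem measurableSet_lt_apply {d : ℕ} (N : Seminorm ℝ (Vec d)) (x : ℝ) (t : ℤ) :
    MeasurableSet {y : PathSpace d | x < N (y t)} :=
  measurableSet_lt measurable_const (measurable_seminorm_apply N t)

theorem measurableSet_exceed {d : ℕ} (N : Seminorm ℝ (Vec d)) (x : ℝ) :
    MeasurableSet (exceed N x) := measurableSet_lt_apply N x 0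

/-- `ν` is the law of a stationary process whose tail process has law `μ`. -/
structure IsTailPair {d : ℕ} (N : Seminorm ℝ (Vec d)) (α : ℝ) (ν μ : Measure (PathSpace d)) :
    Prop where
  prob_left : IsProbabilityMeasure ν
  prob_right : IsProbabilityMeasure μ
  map_shift : ∀ h, ν.map (shiftPath h) = ν
  pareto : ∀ y : ℝ, 1 ≤ y → μ.real {z | y < N (z 0)} = y ^ (-α)
  pos : ∀ x, 0 < ν.real (exceed N x)
  conv : ∀ (H : PathSpace d →ᵇ ℝ) (A : Set (PathSpace d)), MeasurableSet A → μ (frontier A) = 0 →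
    Tendsto (fun x : ℝ => (∫ y in exceed N x ∩ {y | x⁻¹ • y ∈ A}, H (x⁻¹ • y) ∂ν) /
      ν.real (exceed N x)) atTop (𝓝 (∫ z in A, H z ∂μ))

open scoped PiCountable in
theorem IsTailProcess.isTailPair {Ω Ω' : Type*} [MeasurableSpace Ω] [MeasurableSpace Ω'] {d : ℕ}
    {P : Measure Ω} [IsProbabilityMeasure P] {Q : Measure Ω'} [IsProbabilityMeasure Q]
    {N : Seminorm ℝ (Vec d)} {α : ℝ} {X : ℤ → Ω → Vec d} (hXm : ∀ t, Measurable (X t))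
    (hXs : IsStationaryProcess P X) {Y : ℤ → Ω' → Vec d} (hYm : ∀ t, Measurable (Y t))
    (hY : IsTailProcess N α P X Q Y) :
    IsTailPair N α (P.map fun ω t => X t ω) (Q.map fun ω t => Y t ω) := by
  have mX : Measurable fun ω t => X t ω := measurable_pi_lambda _ hXm
  have mY : Measurable fun ω t => Y t ω := measurable_pi_lambda _ hYm
  set ν : Measure (PathSpace d) := P.map fun ω t => X t ω
  set μ : Measure (PathSpace d) := Q.map fun ω t => Y t ω
  have hν : IsProbabilityMeasure ν := Measure.isProbabilityMeasure_map mX.aemeasurable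
  have hμ : IsProbabilityMeasure μ := Measure.isProbabilityMeasure_map mY.aemeasurable
  have hscale : ∀ x : ℝ, Measurable fun y : PathSpace d => x⁻¹ • y := fun x => by
    have : Continuous fun y : PathSpace d => x⁻¹ • y := continuous_const_smul _
    exact this.measurable
  have mwin : ∀ s t : ℤ, Measurable fun (y : PathSpace d) (i : Set.Icc s t) => y i := fun s t =>
    measurable_pi_lambda _ fun i => measurable_pi_apply _
  have hcond : ∀ x : ℝ, ν[|exceed N x] = (P[|{ω | x < N (X 0 ω)}]).map fun ω t => X t ω :=
    fun x => cond_map P mX (measurableSet_exceed N x)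
  have hwin : ∀ s t : ℤ, s ≤ t → WeakConv
      (fun x : ℝ => ((ν[|exceed N x]).map fun y => x⁻¹ • y).map fun y (i : Set.Icc s t) => y i)
      atTop (μ.map fun y (i : Set.Icc s t) => y i) := by
    intro s t hst
    have := hY.2 s t hst
    convert! this using 2
    · rw [hcond, Measure.map_map (hscale _) mX, Measure.map_map (mwin s t) ((hscale _).comp mX)]
      rfl
    · rw [Measure.map_map (mwin s t) mY]
      rfl
  have hpos : ∀ x, 0 < ν.real (exceed N x) := by
    intro x
    -- The constant test function shows that the conditional laws have total mass tending to `1`.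
    -- Conditioning on a null event gives the zero measure, so exceedances of arbitrarily high
    -- levels, and hence of all levels, have positive probability.
    have h1 := hwin 0 0 le_rfl (BoundedContinuousFunction.const _ 1)
    have hp : IsProbabilityMeasure (μ.map fun y (i : Set.Icc (0 : ℤ) 0) => y i) :=
      Measure.isProbabilityMeasure_map (mwin 0 0).aemeasurable
    simp only [BoundedContinuousFunction.const_apply, integral_const, smul_eq_mul, mul_one,
      probReal_univ] at h1
    obtain ⟨x', hx', hxx⟩ := ((h1.eventually_const_lt one_half_lt_one).and
      (eventually_ge_atTop x)).exists
    by_contra hcon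
    have h0 : ν (exceed N x) = 0 := by
      have : ν.real (exceed N x) = 0 := le_antisymm (not_lt.1 hcon) measureReal_nonneg
      rwa [measureReal_eq_zero_iff] at this
    have h0' : ν (exceed N x') = 0 :=
      measure_mono_null (fun y (hy : x' < N (y 0)) => hxx.trans_lt hy) h0
    rw [cond_eq_zero_of_meas_eq_zero h0'] at hx'
    norm_num at hx'
  have hp : ∀ x, IsProbabilityMeasure ((ν[|exceed N x]).map fun y : PathSpace d => x⁻¹ • y) := by
    intro x
    have : IsProbabilityMeasure (ν[|exceed N x]) := cond_isProbabilityMeasure fun h => by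
      have := hpos x
      rw [Measure.real, h] at this
      simp at this
    exact Measure.isProbabilityMeasure_map (hscale x).aemeasurable
  refine ⟨hν, hμ, fun h => ?_, fun y hy => ?_, hpos, fun H A hA hfr => ?_⟩
  · rw [Measure.map_map (measurable_shiftPath h) mX]
    exact hXs h
  · rw [← hY.1 y hy, map_measureReal_apply mY (measurableSet_lt_apply N y 0)]
    rfl
  · have hT : Tendsto (β := ProbabilityMeasure (PathSpace d)) (fun x : ℝ => ⟨_, hp x⟩) atTop
        (𝓝 (⟨μ, hμ⟩ : ProbabilityMeasure (PathSpace d))) := tendsto_path_of_windows fun m => hwin _ _ (by omega)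
    have := tendsto_setIntegral_of_null_frontier hT hA hfr H
    refine this.congr fun x => ?_
    simp only [ProbabilityMeasure.coe_mk]
    rw [setIntegral_map hA H.continuous.measurable.aestronglyMeasurable (hscale x).aemeasurable]
    simp only [ProbabilityTheory.cond, Measure.restrict_smul, integral_smul_measure,
      ENNReal.toReal_inv, smul_eq_mul]
    rw [Measure.restrict_restrict (hscale x hA), inter_comm, div_eq_inv_mul]
    rfl

namespace IsTailPair

variable {d : ℕ} {N : Seminorm ℝ (Vec d)} {α : ℝ} {ν μ : Measure (PathSpace d)}

theorem integral_shift (hT : IsTailPair N α ν μ) (h : ℤ) {g : PathSpace d → ℝ}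
    (hg : Measurable g) : ∫ y, g (shiftPath h y) ∂ν = ∫ y, g y ∂ν := by
  conv_rhs => rw [← hT.map_shift h]
  rw [integral_map (measurable_shiftPath h).aemeasurable hg.aestronglyMeasurable]

theorem real_shift (hT : IsTailPair N α ν μ) (h : ℤ) {A : Set (PathSpace d)}
    (hA : MeasurableSet A) : ν.real {y | shiftPath h y ∈ A} = ν.real A := by
  conv_rhs => rw [← hT.map_shift h]
  rw [map_measureReal_apply (measurable_shiftPath h) hA]
  rfl

theorem real_lt_apply (hT : IsTailPair N α ν μ) (x : ℝ) (t : ℤ) :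
    ν.real {y | x < N (y t)} = ν.real (exceed N x) := by
  rw [← hT.real_shift t (measurableSet_exceed N x)]
  simp [exceed]

theorem conv_const (hT : IsTailPair N α ν μ) {A : Set (PathSpace d)} (hA : MeasurableSet A)
    (hfr : μ (frontier A) = 0) :
    Tendsto (fun x : ℝ => ν.real (exceed N x ∩ {y | x⁻¹ • y ∈ A}) / ν.real (exceed N x)) atTop
      (𝓝 (μ.real A)) := by
  simpa using hT.conv (BoundedContinuousFunction.const _ 1) A hA hfr

/-- The Pareto tail is continuous. This case of `measure_norm_eq` has to come first, because the
regular variation used there rests on it. -/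
theorem real_norm_zero_eq (hT : IsTailPair N α ν μ) {c : ℝ} (hc : 1 ≤ c) :
    μ.real {z | N (z 0) = c} = 0 := by
  have := hT.prob_right
  refine le_antisymm ?_ measureReal_nonneg
  rcases hc.eq_or_lt with rfl | hc
  · have h1 := hT.pareto 1 le_rfl
    have h2 := probReal_compl_eq_one_sub (μ := μ) (measurableSet_lt_apply N 1 0)
    rw [h1, Real.one_rpow, sub_self] at h2
    rw [← h2]
    exact measureReal_mono fun z (hz : N (z 0) = 1) => by simp [hz]
  · have hlim : Tendsto (fun s : ℝ => s ^ (-α) - c ^ (-α)) (𝓝[<] c) (𝓝 0) := by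
      have : ContinuousAt (fun s : ℝ => s ^ (-α)) c :=
        Real.continuousAt_rpow_const c (-α) (Or.inl (by linarith))
      have := (this.tendsto.sub_const (c ^ (-α))).mono_left (nhdsWithin_le_nhds (s := Iio c))
      simpa using this
    refine ge_of_tendsto hlim ?_
    filter_upwards [Ioo_mem_nhdsLT hc] with s hs
    rw [← hT.pareto s hs.1.le, ← hT.pareto c hc.le, ← measureReal_sdiff _
      (measurableSet_lt_apply N c 0)]
    · exact measureReal_mono fun z (hz : N (z 0) = c) =>
        ⟨by simp [hz, hs.2], by simp [hz]⟩
    · exact fun z (hz : c < N (z 0)) => hs.2.trans hz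

theorem exceed_inter_scale {x c : ℝ} (hx : 0 < x) (hc : 1 ≤ c) :
    exceed N x ∩ {y | x⁻¹ • y ∈ {z : PathSpace d | c < N (z 0)}} = exceed N (c * x) := by
  ext y
  simp only [exceed, mem_inter_iff, mem_ofPred_eq, Pi.smul_apply, seminorm_inv_smul N hx,
    lt_div_iff₀ hx, and_iff_right_iff_imp]
  intro h
  nlinarith

theorem frontier_lt_subset (N : Seminorm ℝ (Vec d)) (c : ℝ) (t : ℤ) :
    frontier {z : PathSpace d | c < N (z t)} ⊆ {z | N (z t) = c} := by
  have hcont : Continuous fun z : PathSpace d => N (z t) :=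
    N.continuous_vec.comp (continuous_apply t)
  intro z hz
  exact (frontier_lt_subset_eq continuous_const hcont hz).symm

theorem tendsto_ratio_of_one_le (hT : IsTailPair N α ν μ) {c : ℝ} (hc : 1 ≤ c) :
    Tendsto (fun x : ℝ => ν.real (exceed N (c * x)) / ν.real (exceed N x)) atTop
      (𝓝 (c ^ (-α))) := by
  have := hT.prob_right
  rw [← hT.pareto c hc]
  refine (hT.conv_const (measurableSet_lt_apply N c 0) ?_).congr' ?_
  · exact measure_mono_null (frontier_lt_subset N c 0)
      ((measureReal_eq_zero_iff).1 (hT.real_norm_zero_eq hc))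
  · filter_upwards [eventually_gt_atTop 0] with x hx
    exact congrArg (fun S => ν.real S / ν.real (exceed N x)) (exceed_inter_scale hx hc)

/-- The tail function of the norm is regularly varying of index `-α`. -/
theorem tendsto_ratio (hT : IsTailPair N α ν μ) {c : ℝ} (hc : 0 < c) :
    Tendsto (fun x : ℝ => ν.real (exceed N (c * x)) / ν.real (exceed N x)) atTop
      (𝓝 (c ^ (-α))) := by
  rcases le_total 1 c with h | h
  · exact hT.tendsto_ratio_of_one_le h
  -- For `c ≤ 1` the ratio at `x` is the inverse of the ratio with factor `c⁻¹` at the level `c *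
  -- x`.
  · have h1 := hT.tendsto_ratio_of_one_le (c := c⁻¹) (one_le_inv_iff₀.2 ⟨hc, h⟩)
    have h2 := (h1.comp (tendsto_id.const_mul_atTop hc)).inv₀
      (Real.rpow_pos_of_pos (inv_pos.2 hc) _).ne'
    have e : ((c⁻¹) ^ (-α))⁻¹ = c ^ (-α) := by
      rw [Real.inv_rpow hc.le, inv_inv]
    rw [e] at h2
    refine h2.congr fun x => ?_
    simp only [Function.comp_apply, id, inv_div]
    rw [inv_mul_cancel_left₀ hc.ne']

/-- The norm of the tail process at a fixed time has no atoms in `(0, ∞)`. -/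
theorem measure_norm_eq (hT : IsTailPair N α ν μ) (t : ℤ) {c : ℝ} (hc : 0 < c) :
    μ {z | N (z t) = c} = 0 := by
  have := hT.prob_right
  have := hT.prob_left
  rw [← measureReal_eq_zero_iff]
  refine le_antisymm ?_ measureReal_nonneg
  have hlim : Tendsto (fun δ : ℝ => (c - δ) ^ (-α) - (c + δ) ^ (-α)) (𝓝[>] 0) (𝓝 0) := by
    have h1 : ContinuousAt (fun s : ℝ => (c - s) ^ (-α)) 0 :=
      ContinuousAt.rpow_const (by fun_prop) (Or.inl (by simp; linarith))
    have h2 : ContinuousAt (fun s : ℝ => (c + s) ^ (-α)) 0 :=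
      ContinuousAt.rpow_const (by fun_prop) (Or.inl (by simp; linarith))
    have := (h1.tendsto.sub h2.tendsto).mono_left (nhdsWithin_le_nhds (s := Ioi 0))
    simpa using this
  refine ge_of_tendsto hlim ?_
  filter_upwards [Ioo_mem_nhdsGT hc] with δ hδ
  have hNt : Continuous fun z : PathSpace d => N (z t) :=
    N.continuous_vec.comp (continuous_apply t)
  -- A tent at `c` of half-width `δ`. Dropping the conditioning event from the numerator and using
  -- stationarity, its conditional mean is at most `P((c - δ)x < N(X_0) ≤ (c + δ)x) / P(N(X_0) >
  -- x)`, which tends to `(c - δ)^(-α) - (c + δ)^(-α)`.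
  let φ : PathSpace d → ℝ := fun z => max 0 (1 - |N (z t) - c| / δ)
  have hφc : Continuous φ := by
    exact continuous_const.max (continuous_const.sub
      ((continuous_abs.comp (hNt.sub continuous_const)).div_const δ))
  have hφ1 : ∀ z, φ z ≤ 1 := fun z => max_le zero_le_one (by
    have : 0 ≤ |N (z t) - c| / δ := div_nonneg (abs_nonneg _) hδ.1.le
    linarith)
  have hφ0 : ∀ z, 0 ≤ φ z := fun z => le_max_left _ _
  have hφb : ∀ z, ‖φ z‖ ≤ 1 := fun z => by rw [Real.norm_of_nonneg (hφ0 z)]; exact hφ1 z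
  have hconv := hT.conv (BoundedContinuousFunction.ofNormedAddCommGroup φ hφc 1 hφb) univ
    MeasurableSet.univ (by simp)
  simp only [mem_univ, ofPred_true, inter_univ, BoundedContinuousFunction.coe_ofNormedAddCommGroup,
    Measure.restrict_univ] at hconv
  have hmeas : MeasurableSet {z : PathSpace d | N (z t) = c} :=
    measurableSet_eq_fun (measurable_seminorm_apply N t) measurable_const
  have hle : μ.real {z | N (z t) = c} ≤ ∫ z, φ z ∂μ := by
    rw [← integral_indicator_one hmeas]
    refine integral_mono ((integrable_const (1 : ℝ)).indicator hmeas)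
      (Integrable.of_bound hφc.measurable.aestronglyMeasurable 1 (Eventually.of_forall hφb))
      fun z => ?_
    by_cases hz : N (z t) = c
    · simp [φ, hz]
    · simpa [hz] using hφ0 z
  refine hle.trans (le_of_tendsto_of_tendsto hconv
    ((hT.tendsto_ratio (c := c - δ) (by linarith [hδ.2])).sub
      (hT.tendsto_ratio (c := c + δ) (by linarith [hδ.1]))) ?_)
  filter_upwards [eventually_gt_atTop 0] with x hx
  rw [← sub_div]
  refine div_le_div_of_nonneg_right ?_ measureReal_nonneg
  rw [← hT.real_lt_apply _ t, ← hT.real_lt_apply ((c + δ) * x) t,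
    ← measureReal_sdiff _ (measurableSet_lt_apply N _ t)]
  · have hD : MeasurableSet ({y : PathSpace d | (c - δ) * x < N (y t)} \
        {y | (c + δ) * x < N (y t)}) :=
      (measurableSet_lt_apply N _ t).diff (measurableSet_lt_apply N _ t)
    have hsc : Continuous fun y : PathSpace d => φ (x⁻¹ • y) :=
      hφc.comp (continuous_const_smul _)
    rw [← integral_indicator_one hD, ← integral_indicator (measurableSet_exceed N x)]
    have hi := Integrable.of_bound (μ := ν) hsc.measurable.aestronglyMeasurable 1
      (Eventually.of_forall fun y => hφb _)
    refine integral_mono (hi.indicator (measurableSet_exceed N x))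
      ((integrable_const (1 : ℝ)).indicator hD) fun y => ?_
    refine (indicator_le_self' (fun _ _ => hφ0 _) y).trans ?_
    by_cases hy : y ∈ {y : PathSpace d | (c - δ) * x < N (y t)} \ {y | (c + δ) * x < N (y t)}
    · rw [indicator_of_mem hy]
      exact hφ1 _
    · rw [indicator_of_notMem hy]
      refine max_le le_rfl ?_
      rw [sub_nonpos, one_le_div hδ.1]
      simp only [Pi.smul_apply, seminorm_inv_smul N hx]
      rw [Set.mem_sdiff, not_and_or, not_not] at hy
      rcases hy with hy | hy
      · simp only [mem_ofPred_eq, not_lt] at hy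
        rw [← div_le_iff₀ hx] at hy
        exact le_abs.2 (Or.inr (by linarith))
      · simp only [mem_ofPred_eq] at hy
        rw [← lt_div_iff₀ hx] at hy
        exact le_abs.2 (Or.inl (by linarith))
  · intro y (hy : (c + δ) * x < N (y t))
    show (c - δ) * x < N (y t)
    nlinarith [hδ.1]

theorem frontier_lt_null (hT : IsTailPair N α ν μ) (t : ℤ) {c : ℝ} (hc : 0 < c) :
    μ (frontier {z | c < N (z t)}) = 0 :=
  measure_mono_null (frontier_lt_subset N c t) (hT.measure_norm_eq t hc)

theorem frontier_forall_le_null (hT : IsTailPair N α ν μ) (S : Finset ℤ) {c : ℝ} (hc : 0 < c) :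
    μ (frontier {z | ∀ t ∈ S, N (z t) ≤ c}) = 0 := by
  induction S using Finset.induction_on with
  | empty => simp
  | insert s S _ ih =>
    have e : {z : PathSpace d | ∀ t ∈ insert s S, N (z t) ≤ c}
        = {z | c < N (z s)}ᶜ ∩ {z | ∀ t ∈ S, N (z t) ≤ c} := by
      ext z
      simp
    rw [e]
    refine measure_mono_null ((frontier_inter_subset _ _).trans
      (union_subset_union inter_subset_left inter_subset_right)) (measure_union_null ?_ ih)
    rw [frontier_compl]
    exact hT.frontier_lt_null s hc

theorem measurableSet_forall_le (N : Seminorm ℝ (Vec d)) (S : Set ℤ) (c : ℝ) :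
    MeasurableSet {z : PathSpace d | ∀ t ∈ S, N (z t) ≤ c} := by
  simp only [ofPred_forall]
  exact MeasurableSet.iInter fun t => MeasurableSet.iInter fun _ =>
    measurableSet_le (measurable_seminorm_apply N t) measurable_const

theorem frontier_exists_lt_null (hT : IsTailPair N α ν μ) (S : Finset ℤ) {c : ℝ} (hc : 0 < c) :
    μ (frontier {z | ∃ t ∈ S, c < N (z t)}) = 0 := by
  rw [← hT.frontier_forall_le_null S hc, ← frontier_compl]
  congr 2
  ext z
  simp

theorem measurableSet_exists_lt (N : Seminorm ℝ (Vec d)) (S : Set ℤ) (c : ℝ) :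
    MeasurableSet {z : PathSpace d | ∃ t ∈ S, c < N (z t)} := by
  have := (measurableSet_forall_le N S c).compl
  convert this using 1
  ext z
  simp

/-- The time-change formula of the tail process. -/
theorem time_change (hT : IsTailPair N α ν μ) (s : ℤ) :
    (μ.restrict {z | 1 < N (z s)}).map (shiftPath s) = μ.restrict {z | 1 < N (z (-s))} := by
  have := hT.prob_right
  have := hT.prob_left
  have : IsFiniteMeasure ((μ.restrict {z | 1 < N (z s)}).map (shiftPath s)) := inferInstance
  refine ext_of_forall_integral_eq_of_IsFiniteMeasure fun H => ?_
  rw [integral_map (measurable_shiftPath s).aemeasurable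
    H.continuous.measurable.aestronglyMeasurable]
  have h1 := hT.conv (H.compContinuous ⟨_, continuous_shiftPath s⟩) _
    (measurableSet_lt_apply N 1 s) (hT.frontier_lt_null s one_pos)
  have h2 := hT.conv H _ (measurableSet_lt_apply N 1 (-s)) (hT.frontier_lt_null (-s) one_pos)
  refine tendsto_nhds_unique (h1.congr' ?_) h2
  filter_upwards [eventually_gt_atTop 0] with x hx
  have m : ∀ t : ℤ, MeasurableSet (exceed N x ∩
      {y : PathSpace d | x⁻¹ • y ∈ {z : PathSpace d | 1 < N (z t)}}) := fun t => by
    refine (measurableSet_exceed N x).inter ?_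
    simp only [mem_ofPred_eq, Pi.smul_apply, seminorm_inv_smul N hx, one_lt_div hx]
    exact measurableSet_lt_apply N x t
  suffices key : ∫ y in exceed N x ∩ {y | x⁻¹ • y ∈ {z | 1 < N (z s)}},
      H (shiftPath s (x⁻¹ • y)) ∂ν = ∫ y in exceed N x ∩ {y | x⁻¹ • y ∈ {z | 1 < N (z (-s))}},
      H (x⁻¹ • y) ∂ν from congrArg (· / ν.real (exceed N x)) key
  rw [← integral_indicator (m s), ← integral_indicator (m (-s))]
  have hsc : Continuous fun y : PathSpace d => H (x⁻¹ • y) :=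
    H.continuous.comp (continuous_const_smul _)
  -- Under the shift by `s`, exceedances at times `0` and `-s` become exceedances at times `s` and
  -- `0`: the conditioning event and the extra event trade places.
  rw [← hT.integral_shift s (hsc.measurable.indicator (m (-s)))]
  refine integral_congr_ae (Eventually.of_forall fun y => ?_)
  simp only [indicator, exceed, mem_inter_iff, mem_ofPred_eq, Pi.smul_apply,
    seminorm_inv_smul N hx, one_lt_div hx, shiftPath_apply, zero_add, neg_add_cancel]
  have e : H (shiftPath s (x⁻¹ • y)) = H (x⁻¹ • shiftPath s y) := rfl
  by_cases h0 : x < N (y 0) <;> by_cases hs : x < N (y s) <;> simp [h0, hs, e]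

end IsTailPair

/-! ### Anchoring of the tail process -/

/-- `A` is an anchoring event: almost every path exceeds level `1` at exactly one time from which
it is seen in `A`. -/
structure IsAnchor {d : ℕ} (N : Seminorm ℝ (Vec d)) (μ : Measure (PathSpace d))
    (A : Set (PathSpace d)) : Prop where
  measurableSet : MeasurableSet A
  existsUnique : ∀ᵐ z ∂μ, ∃! s : ℤ, 1 < N (z s) ∧ shiftPath s z ∈ A

namespace IsAnchor

variable {d : ℕ} {N : Seminorm ℝ (Vec d)} {α : ℝ} {ν μ : Measure (PathSpace d)}
  {A A' : Set (PathSpace d)}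

/-- The time selected by the anchor splits almost all of `D` into disjoint pieces. -/
theorem measure_eq_tsum (hA : IsAnchor N μ A) {D : Set (PathSpace d)} (hD : MeasurableSet D) :
    μ D = ∑' s : ℤ, μ (D ∩ ({z | 1 < N (z s)} ∩ shiftPath s ⁻¹' A)) := by
  have hm : ∀ s : ℤ, MeasurableSet (D ∩ ({z | 1 < N (z s)} ∩ shiftPath s ⁻¹' A)) := fun s =>
    hD.inter ((measurableSet_lt_apply N 1 s).inter (measurable_shiftPath s hA.measurableSet))
  rw [← measure_iUnion₀ _ fun s => (hm s).nullMeasurableSet]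
  · refine measure_congr ?_
    filter_upwards [hA.existsUnique] with z hz
    refine propext ⟨fun h => ?_, fun h => ?_⟩
    · obtain ⟨s, hs, -⟩ := hz
      exact mem_iUnion.2 ⟨s, h, hs⟩
    · obtain ⟨s, hs⟩ := mem_iUnion.1 h
      exact hs.1
  · intro s t hst
    refine measure_mono_null (fun z hz => ?_) hA.existsUnique
    exact fun hu => hst (hu.unique hz.1.2 hz.2.2)

/-- A mass-transport identity: paths anchored by `A` at `0` and by `A'` at `s` become, seen from
`s`, paths anchored by `A'` at `0` and by `A` at `-s`. It is the time-change formula evaluated on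
`A' ∩ shiftPath (-s) ⁻¹' A`. -/
theorem measure_inter_shift (hT : IsTailPair N α ν μ) (s : ℤ) (hA : MeasurableSet A)
    (hA' : MeasurableSet A') :
    μ (A ∩ ({z | 1 < N (z s)} ∩ shiftPath s ⁻¹' A'))
      = μ (A' ∩ ({z | 1 < N (z (-s))} ∩ shiftPath (-s) ⁻¹' A)) := by
  have hm : MeasurableSet (A' ∩ shiftPath (-s) ⁻¹' A) :=
    hA'.inter (measurable_shiftPath _ hA)
  have h := congrArg (fun ρ => ρ (A' ∩ shiftPath (-s) ⁻¹' A)) (hT.time_change s)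
  beta_reduce at h
  rw [Measure.map_apply (measurable_shiftPath s) hm,
    Measure.restrict_apply (measurable_shiftPath s hm), Measure.restrict_apply hm] at h
  convert h using 2
  · ext z
    simp only [mem_inter_iff, mem_preimage, shiftPath_shiftPath, neg_add_cancel, shiftPath_zero]
    tauto
  · ext z
    simp only [mem_inter_iff, mem_preimage]
    tauto

/-- Shift-invariant events have the same mass on any two anchoring events. -/
theorem measure_inter_eq (hT : IsTailPair N α ν μ) (hA : IsAnchor N μ A) (hA' : IsAnchor N μ A')
    {B : Set (PathSpace d)} (hB : MeasurableSet B) (hinv : ∀ s z, shiftPath s z ∈ B ↔ z ∈ B) :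
    μ (A ∩ B) = μ (A' ∩ B) := by
  -- Each side is split by the anchor of the other; the terms with lags `s` and `-s` then agree by
  -- mass transport.
  rw [hA'.measure_eq_tsum (hA.measurableSet.inter hB),
    hA.measure_eq_tsum (hA'.measurableSet.inter hB), ← (Equiv.neg ℤ).tsum_eq]
  refine tsum_congr fun s => ?_
  simp only [Equiv.neg_apply]
  have e : ∀ (A A' : Set (PathSpace d)) (s : ℤ),
      A ∩ B ∩ ({z | 1 < N (z s)} ∩ shiftPath s ⁻¹' A')
        = A ∩ ({z | 1 < N (z s)} ∩ shiftPath s ⁻¹' (A' ∩ B)) := fun A A' s => by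
    ext z
    simp only [mem_inter_iff, mem_preimage, hinv]
    tauto
  rw [e, measure_inter_shift hT _ hA.measurableSet (hA'.measurableSet.inter hB), neg_neg]

theorem measure_eq (hT : IsTailPair N α ν μ) (hA : IsAnchor N μ A) (hA' : IsAnchor N μ A') :
    μ A = μ A' := by
  simpa using measure_inter_eq hT hA hA' MeasurableSet.univ (by simp)

/-- Applied to the point measure of a path, this exchanges the first exceedance for the first
maximum in the limit law. -/
theorem map_restrict_eq (hT : IsTailPair N α ν μ) (hA : IsAnchor N μ A) (hA' : IsAnchor N μ A')
    {S : Type*} [MeasurableSpace S] {q : PathSpace d → S} (hq : Measurable q)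
    (hinv : ∀ s z, q (shiftPath s z) = q z) :
    (μ.restrict A).map q = (μ.restrict A').map q := by
  ext B hB
  rw [Measure.map_apply hq hB, Measure.map_apply hq hB, Measure.restrict_apply (hq hB),
    Measure.restrict_apply (hq hB), inter_comm _ A, inter_comm _ A']
  exact measure_inter_eq hT hA hA' (hq hB) fun s z => by simp only [mem_preimage, hinv]

/-- If `A` were null, mass transport would make every piece of the decomposition of the whole space
null, although the total mass is `1`. -/
theorem measure_pos (hT : IsTailPair N α ν μ) (hA : IsAnchor N μ A) : 0 < μ A := by
  have := hT.prob_right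
  by_contra h
  have h0 : μ A = 0 := by simpa using h
  have h1 := hA.measure_eq_tsum (D := univ) MeasurableSet.univ
  have h2 : ∀ s : ℤ, μ (univ ∩ ({z | 1 < N (z s)} ∩ shiftPath s ⁻¹' A)) = 0 := fun s => by
    rw [measure_inter_shift hT s MeasurableSet.univ hA.measurableSet]
    exact measure_mono_null inter_subset_left h0
  simp only [h2, tsum_zero, measure_univ] at h1
  exact one_ne_zero h1

end IsAnchor

/-! ### Existence and uniqueness of the selected times of a null sequence -/

theorem finite_setOf_lt_of_tendsto_zero {f : ℤ → ℝ} (hf : Tendsto f cofinite (𝓝 0)) {c : ℝ}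
    (hc : 0 < c) : {t | c < f t}.Finite := by
  have := hf.eventually_lt_const hc
  rw [eventually_cofinite] at this
  exact this.subset fun t (ht : c < f t) => not_lt.2 ht.le

theorem existsUnique_first_exceedance {f : ℤ → ℝ} (hf : Tendsto f cofinite (𝓝 0))
    (h0 : 1 < f 0) : ∃! s : ℤ, 1 < f s ∧ ∀ t ∈ Iio (0 : ℤ), f (t + s) ≤ 1 := by
  have hfin := finite_setOf_lt_of_tendsto_zero hf one_pos
  obtain ⟨s, hs, hmin⟩ := hfin.exists_minimalFor id _ ⟨0, h0⟩
  have hmin' : ∀ t, 1 < f t → s ≤ t := fun t ht => by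
    rcases le_total t s with h | h
    · exact hmin ht h
    · exact h
  refine ⟨s, ⟨hs, fun t (ht : t < 0) => not_lt.1 fun h => ?_⟩, fun s' ⟨h1, h2⟩ => ?_⟩
  · have := hmin' _ h
    omega
  · refine le_antisymm (not_lt.1 fun h => ?_) (hmin' _ h1)
    have := h2 (s - s') (by simp only [mem_Iio]; omega)
    rw [sub_add_cancel] at this
    exact not_lt.2 this hs

/-- Time reversal of `existsUnique_first_exceedance`. -/
theorem existsUnique_last_exceedance {f : ℤ → ℝ} (hf : Tendsto f cofinite (𝓝 0))
    (h0 : 1 < f 0) : ∃! s : ℤ, 1 < f s ∧ ∀ t ∈ Ici (1 : ℤ), f (t + s) ≤ 1 := by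
  have hg : Tendsto (fun t => f (-t)) cofinite (𝓝 0) :=
    hf.comp neg_injective.tendsto_cofinite
  obtain ⟨s, ⟨hs1, hs2⟩, hs3⟩ := existsUnique_first_exceedance hg (by simpa using h0)
  refine ⟨-s, ⟨hs1, fun t (ht : 1 ≤ t) => ?_⟩, fun s' ⟨h1, h2⟩ => ?_⟩
  · have := hs2 (-t) (by simp only [mem_Iio]; omega)
    rwa [neg_add, neg_neg] at this
  · have := hs3 (-s') ⟨by simpa using h1, fun t (ht : t < 0) => ?_⟩
    · omega
    · have := h2 (-t) (by simp only [mem_Ici]; omega)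
      rwa [show -(t + -s') = -t + s' by ring]

/-- Only finitely many terms exceed `1`, so the maximum is attained, and at finitely many times; the
smallest of these is the one selected. -/
theorem existsUnique_first_maximum {f : ℤ → ℝ} (hf : Tendsto f cofinite (𝓝 0))
    (h0 : 1 < f 0) : ∃! s : ℤ, 1 < f s ∧ (∀ t < 0, f (t + s) < f s) ∧ ∀ t, f (t + s) ≤ f s := by
  have hfin := finite_setOf_lt_of_tendsto_zero hf one_pos
  obtain ⟨m, hm, hmax⟩ := hfin.exists_maximalFor f _ ⟨0, h0⟩
  have hmax' : ∀ t, f t ≤ f m := fun t => by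
    rcases le_total (f m) (f t) with h | h
    · exact hmax (show 1 < f t from lt_of_lt_of_le hm h) h
    · exact h
  have hfin2 : {t | f t = f m}.Finite := hfin.subset fun t (ht : f t = f m) =>
    show 1 < f t by rw [ht]; exact hm
  obtain ⟨s, hs, hmin⟩ := hfin2.exists_minimalFor id _ ⟨m, rfl⟩
  have hs : f s = f m := hs
  refine ⟨s, ⟨hs ▸ hm, fun t ht => lt_of_le_of_ne (hs ▸ hmax' _) fun h => ?_,
    fun t => hs ▸ hmax' _⟩, fun s' ⟨h1, h2, h3⟩ => ?_⟩
  · have : s ≤ t + s := hmin (h.trans hs) (by simp only [id]; omega)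
    omega
  · have e : f s' = f m := le_antisymm (hmax' _) (by simpa using h3 (m - s'))
    rcases lt_trichotomy s' s with h | h | h
    · have : s ≤ s' := hmin e h.le
      omega
    · exact h
    · have := h2 (s - s') (by omega)
      rw [sub_add_cancel, hs, e] at this
      exact absurd this (lt_irrefl _)

theorem supNorm_le_one_iff {d : ℕ} (N : Seminorm ℝ (Vec d)) (S : Set ℤ) (z : PathSpace d) :
    supNorm N S z ≤ 1 ↔ ∀ t ∈ S, N (z t) ≤ 1 := by
  simp [supNorm]

/-- The paths whose norm attains its supremum for the first time at `0`. -/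
def firstMaxPaths {d : ℕ} (N : Seminorm ℝ (Vec d)) : Set (PathSpace d) :=
  firstMaxAtZero N fun t z => z t

theorem measurableSet_firstMaxPaths {d : ℕ} (N : Seminorm ℝ (Vec d)) :
    MeasurableSet (firstMaxPaths N) := by
  have h : ∀ S : Set ℤ, Measurable fun z : PathSpace d => supNorm N S fun t => z t := fun S =>
    Measurable.iSup fun t => Measurable.iSup fun _ =>
      (measurable_seminorm_apply N t).ennreal_ofReal
  have h0 := (measurable_seminorm_apply N 0 : Measurable fun y : PathSpace d => _).ennreal_ofReal
  exact (measurableSet_lt (h _) h0).inter (measurableSet_eq_fun h0 (h _))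

theorem mem_firstMaxPaths_iff {d : ℕ} (N : Seminorm ℝ (Vec d)) {z : PathSpace d}
    (hz : Tendsto (fun t => N (z t)) cofinite (𝓝 0)) (h0 : 1 < N (z 0)) :
    z ∈ firstMaxPaths N ↔ (∀ t < 0, N (z t) < N (z 0)) ∧ ∀ t, N (z t) ≤ N (z 0) := by
  have hpos : 0 < N (z 0) := one_pos.trans h0
  simp only [firstMaxPaths, firstMaxAtZero, mem_ofPred_eq]
  constructor
  · rintro ⟨h1, h2⟩
    refine ⟨fun t ht => ?_, fun t => ?_⟩
    · refine (ENNReal.ofReal_lt_ofReal_iff hpos).1 (lt_of_le_of_lt ?_ h1)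
      exact le_iSup₂ (f := fun t (_ : t ∈ Iio (0 : ℤ)) => ENNReal.ofReal (N (z t))) t ht
    · refine (ENNReal.ofReal_le_ofReal_iff hpos.le).1 ?_
      rw [h2]
      exact le_iSup₂ (f := fun t (_ : t ∈ (univ : Set ℤ)) => ENNReal.ofReal (N (z t))) t
        (mem_univ t)
  · rintro ⟨h1, h2⟩
    refine ⟨?_, le_antisymm ?_ ?_⟩
    · have hfin := finite_setOf_lt_of_tendsto_zero hz one_pos
      have hfin' : ({t | 1 < N (z t)} ∩ Iio 0).Finite := hfin.subset inter_subset_left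
      have hpos' : 0 < ENNReal.ofReal (N (z 0)) := ENNReal.ofReal_pos.2 hpos
      -- A supremum of values below `N (z 0)` could equal `N (z 0)`. Here all but finitely many
      -- values are at most `1 < N (z 0)`, so the supremum is bounded by the larger of `1` and a
      -- finite maximum.
      refine lt_of_le_of_lt (b := max 1 (hfin'.toFinset.sup fun t => ENNReal.ofReal (N (z t))))
        (iSup₂_le fun t ht => ?_) (max_lt ?_ ((Finset.sup_lt_iff hpos').2 fun t ht => ?_))
      · by_cases h : 1 < N (z t)
        · exact le_max_of_le_right (Finset.le_sup (f := fun t => ENNReal.ofReal (N (z t)))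
            (hfin'.mem_toFinset.2 ⟨h, ht⟩))
        · exact le_max_of_le_left (ENNReal.ofReal_le_one.2 (not_lt.1 h))
      · simpa using h0
      · exact (ENNReal.ofReal_lt_ofReal_iff hpos).2 (h1 t (hfin'.mem_toFinset.1 ht).2)
    · exact le_iSup₂ (f := fun t (_ : t ∈ (univ : Set ℤ)) => ENNReal.ofReal (N (z t))) 0
        (mem_univ 0)
    · exact iSup₂_le fun t _ => ENNReal.ofReal_le_ofReal (h2 t)

theorem shiftPath_mem_null {d : ℕ} {N : Seminorm ℝ (Vec d)} {z : PathSpace d}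
    (hz : Tendsto (fun t => N (z t)) cofinite (𝓝 0)) (s : ℤ) :
    Tendsto (fun t => N (shiftPath s z t)) cofinite (𝓝 0) :=
  hz.comp (add_left_injective s).tendsto_cofinite

section anchors

variable {d : ℕ} {N : Seminorm ℝ (Vec d)} {μ : Measure (PathSpace d)}

theorem isAnchor_firstExceedance
    (hμ : ∀ᵐ z ∂μ, Tendsto (fun t => N (z t)) cofinite (𝓝 0)) (h0 : ∀ᵐ z ∂μ, 1 < N (z 0)) :
    IsAnchor N μ {z | ∀ t ∈ Iio (0 : ℤ), N (z t) ≤ 1} where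
  measurableSet := IsTailPair.measurableSet_forall_le N _ 1
  existsUnique := by
    filter_upwards [hμ, h0] with z hz hz0
    exact existsUnique_first_exceedance hz hz0

theorem isAnchor_lastExceedance
    (hμ : ∀ᵐ z ∂μ, Tendsto (fun t => N (z t)) cofinite (𝓝 0)) (h0 : ∀ᵐ z ∂μ, 1 < N (z 0)) :
    IsAnchor N μ {z | ∀ t ∈ Ici (1 : ℤ), N (z t) ≤ 1} where
  measurableSet := IsTailPair.measurableSet_forall_le N _ 1
  existsUnique := by
    filter_upwards [hμ, h0] with z hz hz0
    exact existsUnique_last_exceedance hz hz0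

theorem isAnchor_firstMaxPaths
    (hμ : ∀ᵐ z ∂μ, Tendsto (fun t => N (z t)) cofinite (𝓝 0)) (h0 : ∀ᵐ z ∂μ, 1 < N (z 0)) :
    IsAnchor N μ (firstMaxPaths N) where
  measurableSet := measurableSet_firstMaxPaths N
  existsUnique := by
    filter_upwards [hμ, h0] with z hz hz0
    have := existsUnique_first_maximum hz hz0
    refine (existsUnique_congr fun s => and_congr_right fun hs => ?_).1 this
    rw [mem_firstMaxPaths_iff N (shiftPath_mem_null hz s) (by simpa using hs)]
    simp

end anchors

/-! ### Paths vanishing at infinity and their point measures -/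

/-- Null paths carry the sup distance because, in the product topology, points of the point measure
could arrive from infinitely distant times and `pathPointMeasure` would not be continuous. -/
instance (d : ℕ) : MeasurableSpace C₀(ℤ, Vec d) := borel _

instance (d : ℕ) : BorelSpace C₀(ℤ, Vec d) := ⟨rfl⟩

/-- A path that vanishes at infinity, as an element of `C₀`. -/
def nullPath {d : ℕ} (y : PathSpace d) (h : Tendsto y cofinite (𝓝 0)) : C₀(ℤ, Vec d) where
  toFun := y
  continuous_toFun := continuous_of_discreteTopology
  zero_at_infty' := by rwa [cocompact_eq_cofinite]

@[simp] theorem nullPath_apply {d : ℕ} (y : PathSpace d) (h : Tendsto y cofinite (𝓝 0)) (t : ℤ) :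
    nullPath y h t = y t := rfl

theorem tendsto_ite_finset {d : ℕ} (S : Finset ℤ) (y : PathSpace d) :
    Tendsto (fun t => if t ∈ S then y t else 0) cofinite (𝓝 0) := by
  refine tendsto_const_nhds.congr' ?_
  filter_upwards [S.finite_toSet.compl_mem_cofinite] with t ht
  rw [if_neg (by simpa using ht)]

/-- The path `y` set to `0` outside of the finite set `S` of times. -/
def truncPath {d : ℕ} (S : Finset ℤ) (y : PathSpace d) : C₀(ℤ, Vec d) :=
  nullPath (fun t => if t ∈ S then y t else 0) (tendsto_ite_finset S y)

@[simp] theorem truncPath_apply {d : ℕ} (S : Finset ℤ) (y : PathSpace d) (t : ℤ) :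
    truncPath S y t = if t ∈ S then y t else 0 := rfl

open Classical in
/-- The path `y` as an element of `C₀`, or `0` if `y` does not vanish at infinity. -/
def toNullPath {d : ℕ} (y : PathSpace d) : C₀(ℤ, Vec d) :=
  if h : Tendsto y cofinite (𝓝 0) then nullPath y h else 0

theorem dist_nullPath_le_iff {d : ℕ} {f g : C₀(ℤ, Vec d)} {C : ℝ} (hC : 0 ≤ C) :
    dist f g ≤ C ↔ ∀ t, dist (f t) (g t) ≤ C := by
  rw [← ZeroAtInftyContinuousMap.dist_toBCF_eq_dist, BoundedContinuousFunction.dist_le hC]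
  rfl

theorem dist_apply_le {d : ℕ} (f g : C₀(ℤ, Vec d)) (t : ℤ) : dist (f t) (g t) ≤ dist f g :=
  (dist_nullPath_le_iff dist_nonneg).1 le_rfl t

theorem continuous_truncPath {d : ℕ} (S : Finset ℤ) : Continuous (truncPath (d := d) S) := by
  refine continuous_iff_continuousAt.2 fun y => tendsto_iff_dist_tendsto_zero.2 ?_
  have h : Tendsto (fun z : PathSpace d => ∑ t ∈ S, dist (z t) (y t)) (𝓝 y) (𝓝 0) := by
    have : Continuous fun z : PathSpace d => ∑ t ∈ S, dist (z t) (y t) := by fun_prop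
    simpa using this.tendsto y
  refine squeeze_zero (fun _ => dist_nonneg) (fun z => ?_) h
  refine (dist_nullPath_le_iff (Finset.sum_nonneg fun _ _ => dist_nonneg)).2 fun t => ?_
  simp only [truncPath_apply]
  split_ifs with ht
  · exact Finset.single_le_sum (f := fun t => dist (z t) (y t)) (fun _ _ => dist_nonneg) ht
  · simpa using Finset.sum_nonneg fun _ _ => dist_nonneg

theorem tendsto_truncPath {d : ℕ} {y : PathSpace d} (h : Tendsto y cofinite (𝓝 0)) :
    Tendsto (fun m : ℕ => truncPath (Finset.Icc (-(m : ℤ)) m) y) atTop (𝓝 (nullPath y h)) := by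
  rw [Metric.tendsto_atTop]
  intro ε hε
  have h1 : ∀ᶠ t in cofinite, dist (y t) 0 < ε / 2 := (Metric.tendsto_nhds.1 h) _ (by positivity)
  rw [eventually_cofinite] at h1
  refine ⟨h1.toFinset.sup Int.natAbs, fun m hm => ?_⟩
  refine lt_of_le_of_lt ((dist_nullPath_le_iff (C := ε / 2) (by positivity)).2 fun t => ?_)
    (by linarith)
  simp only [truncPath_apply, nullPath_apply]
  split_ifs with ht
  · simp; positivity
  · rw [dist_comm]
    by_contra hcon
    have : t ∈ h1.toFinset := h1.mem_toFinset.2 fun hh => hcon hh.le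
    have := (Finset.le_sup (f := Int.natAbs) this).trans hm
    exact ht (Finset.mem_Icc.2 ⟨by omega, by omega⟩)

theorem measurableSet_tendsto_cofinite (d : ℕ) :
    MeasurableSet {y : PathSpace d | Tendsto y cofinite (𝓝 0)} := by
  have : (cofinite : Filter ℤ).IsCountablyGenerated := by
    rw [Int.cofinite_eq]
    infer_instance
  exact measurableSet_tendsto (𝓝 0) fun t : ℤ => measurable_pi_apply t

theorem toNullPath_of_tendsto {d : ℕ} {y : PathSpace d} (h : Tendsto y cofinite (𝓝 0)) :
    toNullPath y = nullPath y h := dif_pos h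

/-- On the measurable set of null paths it is the pointwise limit of the truncations, which are
continuous from the product topology to `C₀`. -/
theorem measurable_toNullPath {d : ℕ} : Measurable (toNullPath (d := d)) := by
  classical
  refine measurable_of_tendsto_metrizable (f := fun (m : ℕ) y =>
    if Tendsto y cofinite (𝓝 0) then truncPath (Finset.Icc (-(m : ℤ)) m) y else 0) (fun m =>
      Measurable.ite (measurableSet_tendsto_cofinite d) (continuous_truncPath _).measurable
        measurable_const) (tendsto_pi_nhds.2 fun y => ?_)
  by_cases h : Tendsto y cofinite (𝓝 0)
  · simpa only [h, if_true, toNullPath_of_tendsto] using tendsto_truncPath h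
  · simpa only [h, if_false, toNullPath, dif_neg, not_false_eq_true] using tendsto_const_nhds

/-! ### Point measures -/

theorem PointMeasure.ext_measure {d : ℕ} {ν ν' : PointMeasure d}
    (h : ν.toMeasure = ν'.toMeasure) : ν = ν' := by
  cases ν
  cases ν'
  congr

/-- A point measure is determined by its underlying measure, so the choice made in `toPointMeasure`
is harmless. -/
theorem toPointMeasure_toMeasure {d : ℕ} (ν : PointMeasure d) :
    toPointMeasure ν.toMeasure = ν := by
  have h : ∃ ν' : PointMeasure d, ν'.toMeasure = ν.toMeasure := ⟨ν, rfl⟩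
  rw [toPointMeasure, dif_pos h]
  exact PointMeasure.ext_measure h.choose_spec

/-- The inclusion of `ℝ^d` into `[-∞, ∞]^d`. -/
def toEReal {d : ℕ} (v : Vec d) : Fin d → EReal := fun j => (v j : EReal)

theorem continuous_toEReal {d : ℕ} : Continuous (toEReal (d := d)) :=
  continuous_pi fun j => continuous_coe_real_ereal.comp (continuous_apply j)

@[simp] theorem toEReal_zero {d : ℕ} : toEReal (0 : Vec d) = 0 := by
  funext j
  simp [toEReal]

theorem toEReal_ne_zero_iff {d : ℕ} {v : Vec d} : toEReal v ≠ 0 ↔ v ≠ 0 := by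
  refine not_congr ⟨fun h => ?_, fun h => by rw [h, toEReal_zero]⟩
  funext j
  have := congrFun h j
  simpa [toEReal] using this

theorem atom_of_ne {d : ℕ} {v : Vec d} (h : toEReal v ≠ 0) :
    atom v = Measure.dirac (⟨toEReal v, h⟩ : StateSpace d) := dif_pos h

@[simp] theorem atom_zero {d : ℕ} : atom (0 : Vec d) = 0 :=
  dif_neg fun h => h (toEReal_zero (d := d))

theorem atom_apply {d : ℕ} (v : Vec d) {B : Set (StateSpace d)} (hB : MeasurableSet B) :
    atom v B = {v : Vec d | ∃ h : toEReal v ≠ 0, (⟨toEReal v, h⟩ : StateSpace d) ∈ B}.indicator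
      1 v := by
  by_cases h : toEReal v = 0
  · have h0 : v = 0 := by
      by_contra hv
      exact toEReal_ne_zero_iff.2 hv h
    subst h0
    simp
  · rw [atom_of_ne h, Measure.dirac_apply' _ hB]
    have hiff : (⟨toEReal v, h⟩ : StateSpace d) ∈ B ↔
        v ∈ {v : Vec d | ∃ h : toEReal v ≠ 0, (⟨toEReal v, h⟩ : StateSpace d) ∈ B} :=
      ⟨fun hm => ⟨h, hm⟩, fun ⟨_, hm⟩ => hm⟩
    by_cases hm : (⟨toEReal v, h⟩ : StateSpace d) ∈ B
    · rw [indicator_of_mem hm, indicator_of_mem (hiff.1 hm)]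
      rfl
    · rw [indicator_of_notMem hm, indicator_of_notMem fun h' => hm (hiff.2 h')]

theorem atomSum_apply {d : ℕ} {ι : Type*} (y : ι → Vec d) {B : Set (StateSpace d)}
    (hB : MeasurableSet B) :
    atomSum y B = ({t | ∃ h : toEReal (y t) ≠ 0, (⟨toEReal (y t), h⟩ : StateSpace d) ∈ B}.encard :
      ℝ≥0∞) := by
  rw [atomSum, Measure.sum_apply _ hB, ← ENNReal.tsum_set_one,
    tsum_subtype _ fun _ => (1 : ℝ≥0∞)]
  refine tsum_congr fun t => ?_
  rw [atom_apply _ hB]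
  simp [indicator]

/-- Viewed in `[-∞, ∞]^d`, `K` is still compact, hence closed, and it misses the origin. -/
theorem isCompact_norm_bound {d : ℕ} {K : Set (StateSpace d)} (hK : IsCompact K) :
    ∃ δ : ℝ, 0 < δ ∧ ∀ v : Vec d, ‖v‖ < δ → ∀ h : toEReal v ≠ 0,
      (⟨toEReal v, h⟩ : StateSpace d) ∉ K := by
  have h1 : IsClosed (Subtype.val '' K) := (hK.image continuous_subtype_val).isClosed
  have h2 : (Subtype.val '' K)ᶜ ∈ 𝓝 (toEReal (0 : Vec d)) := by
    refine h1.isOpen_compl.mem_nhds ?_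
    rintro ⟨z, -, hz⟩
    exact z.2 (hz.trans toEReal_zero)
  obtain ⟨δ, hδ, hball⟩ := Metric.mem_nhds_iff.1 (continuous_toEReal.continuousAt h2)
  refine ⟨δ, hδ, fun v hv h hK => ?_⟩
  exact hball (show v ∈ Metric.ball 0 δ by simpa using hv) ⟨_, hK, rfl⟩

theorem finite_norm_ge {d : ℕ} {y : PathSpace d} (hy : Tendsto y cofinite (𝓝 0)) {δ : ℝ}
    (hδ : 0 < δ) : {t | δ ≤ ‖y t‖}.Finite := by
  have h1 : ∀ᶠ t in cofinite, dist (y t) 0 < δ := (Metric.tendsto_nhds.1 hy) _ hδ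
  rw [eventually_cofinite] at h1
  refine h1.subset fun t ht => ?_
  simpa using ht

/-- The point measure `∑_t δ_{f_t}` of a path that vanishes at infinity. -/
def pathPointMeasure {d : ℕ} (f : C₀(ℤ, Vec d)) : PointMeasure d where
  toMeasure := atomSum f
  finite_on_compacts := fun K hK => by
    obtain ⟨δ, hδ, h⟩ := isCompact_norm_bound hK
    have hf : Tendsto f cofinite (𝓝 0) := by
      have := f.zero_at_infty'
      rwa [cocompact_eq_cofinite] at this
    rw [atomSum_apply _ hK.measurableSet]
    have : {t | ∃ h : toEReal (f t) ≠ 0, (⟨toEReal (f t), h⟩ : StateSpace d) ∈ K}.Finite := by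
      refine (finite_norm_ge hf hδ).subset ?_
      rintro t ⟨h0, hK⟩
      exact not_lt.1 fun hlt => h _ hlt h0 hK
    rw [← this.cast_ncard_eq]
    simp
  integer_valued := fun B hB => ⟨_, atomSum_apply _ hB⟩

theorem atomSum_comp_equiv {d : ℕ} {ι κ : Type*} (e : ι ≃ κ) (y : κ → Vec d) :
    atomSum (fun t => y (e t)) = atomSum y := by
  ext B hB
  rw [atomSum, atomSum, Measure.sum_apply _ hB, Measure.sum_apply _ hB]
  exact e.tsum_eq fun t => atom (y t) B

/-- A shift only relabels the atoms. Paths that are not null all go to `0`, so the invariance holds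
for every path, as `map_restrict_eq` requires. -/
theorem pathPointMeasure_toNullPath_shiftPath {d : ℕ} (s : ℤ) (y : PathSpace d) :
    pathPointMeasure (toNullPath (shiftPath s y)) = pathPointMeasure (toNullPath y) := by
  by_cases h : Tendsto y cofinite (𝓝 0)
  · have h' : Tendsto (shiftPath s y) cofinite (𝓝 0) :=
      h.comp (add_left_injective s).tendsto_cofinite
    rw [toNullPath_of_tendsto h, toNullPath_of_tendsto h']
    exact PointMeasure.ext_measure (atomSum_comp_equiv (Equiv.addRight s) y)
  · have h' : ¬ Tendsto (shiftPath s y) cofinite (𝓝 0) := fun h' => h (by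
      have := h'.comp (add_left_injective (-s)).tendsto_cofinite
      refine this.congr fun t => ?_
      simp)
    rw [toNullPath, toNullPath, dif_neg h, dif_neg h']

theorem pathPointMeasure_truncPath_shiftPath {d : ℕ} (a b s : ℤ) (y : PathSpace d) :
    pathPointMeasure (truncPath (Finset.Icc (a - s) (b - s)) (shiftPath s y))
      = pathPointMeasure (truncPath (Finset.Icc a b) y) := by
  refine PointMeasure.ext_measure (Eq.trans ?_ (atomSum_comp_equiv (Equiv.addRight s) _))
  refine congrArg atomSum (funext fun t => ?_)
  simp only [truncPath_apply, shiftPath_apply, Equiv.coe_addRight, Finset.mem_Icc]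
  refine if_congr ?_ rfl rfl
  constructor <;> rintro ⟨h1, h2⟩ <;> constructor <;> omega

/-- A test function on the state space, extended by `0` and restricted to `ℝ^d`. -/
def testExtension {d : ℕ} (f : C_c(StateSpace d, ℝ≥0)) (v : Vec d) : ℝ≥0 := by
  classical
  exact if h : toEReal v ≠ 0 then f ⟨toEReal v, h⟩ else 0

theorem testExtension_of_ne {d : ℕ} (f : C_c(StateSpace d, ℝ≥0)) {v : Vec d}
    (h : toEReal v ≠ 0) : testExtension f v = f ⟨toEReal v, h⟩ := dif_pos h

theorem exists_testExtension_eq_zero {d : ℕ} (f : C_c(StateSpace d, ℝ≥0)) :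
    ∃ δ : ℝ, 0 < δ ∧ ∀ v : Vec d, ‖v‖ < δ → testExtension f v = 0 := by
  obtain ⟨δ, hδ, h⟩ := isCompact_norm_bound f.hasCompactSupport.isCompact
  refine ⟨δ, hδ, fun v hv => ?_⟩
  by_cases h0 : toEReal v ≠ 0
  · rw [testExtension_of_ne f h0]
    exact image_eq_zero_of_notMem_tsupport (h v hv h0)
  · exact dif_neg h0

theorem continuous_testExtension {d : ℕ} (f : C_c(StateSpace d, ℝ≥0)) :
    Continuous (testExtension f) := by
  refine continuous_iff_continuousAt.2 fun v => ?_
  by_cases h0 : v = 0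
  · obtain ⟨δ, hδ, h⟩ := exists_testExtension_eq_zero f
    have : testExtension f =ᶠ[𝓝 v] fun _ => 0 := by
      subst h0
      filter_upwards [Metric.ball_mem_nhds (0 : Vec d) hδ] with w hw
      exact h w (by simpa using hw)
    exact continuousAt_const.congr this.symm
  · have hopen : IsOpen {w : Vec d | w ≠ 0} := isOpen_ne
    have : ContinuousOn (testExtension f) {w : Vec d | w ≠ 0} := by
      rw [continuousOn_iff_continuous_domRestrict]
      have e : ({w : Vec d | w ≠ 0}).domRestrict (testExtension f)
          = fun w => f ⟨toEReal w.1, toEReal_ne_zero_iff.2 w.2⟩ :=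
        funext fun w => testExtension_of_ne f _
      rw [e]
      exact f.continuous.comp
        ((continuous_toEReal.comp continuous_subtype_val).subtype_mk _)
    exact this.continuousAt (hopen.mem_nhds h0)

theorem lintegral_atomSum {d : ℕ} {ι : Type*} (f : C_c(StateSpace d, ℝ≥0)) (y : ι → Vec d) :
    ∫⁻ z, (f z : ℝ≥0∞) ∂(atomSum y) = ∑' t, (testExtension f (y t) : ℝ≥0∞) := by
  rw [atomSum, lintegral_sum_measure]
  refine tsum_congr fun t => ?_
  by_cases h : toEReal (y t) ≠ 0
  · rw [atom_of_ne h, testExtension_of_ne f h]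
    exact lintegral_dirac' _ (ENNReal.continuous_coe.comp f.continuous).measurable
  · rw [testExtension, dif_neg h]
    have : atom (y t) = 0 := dif_neg h
    simp [this]

/-- A test function vanishes on a `δ`-ball around the origin. For all paths within `δ / 2` of `y`
its integral therefore involves only the finitely many times with `‖y t‖ ≥ δ / 2`, and is a finite
sum of continuous functions. -/
theorem continuous_pathPointMeasure {d : ℕ} : Continuous (pathPointMeasure (d := d)) := by
  refine continuous_induced_rng.2 (continuous_pi fun f => continuous_iff_continuousAt.2 fun y => ?_)
  obtain ⟨δ, hδ, h⟩ := exists_testExtension_eq_zero f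
  have hy : Tendsto y cofinite (𝓝 0) := by
    have := y.zero_at_infty'
    rwa [cocompact_eq_cofinite] at this
  have hfin := finite_norm_ge hy (half_pos hδ)
  have hcont : Continuous fun z : C₀(ℤ, Vec d) =>
      ∑ t ∈ hfin.toFinset, (testExtension f (z t) : ℝ≥0∞) := by
    refine continuous_finsetSum _ fun t _ => ENNReal.continuous_coe.comp
      ((continuous_testExtension f).comp ?_)
    exact Metric.continuous_iff.2 fun b ε hε =>
      ⟨ε, hε, fun a ha => (dist_apply_le a b t).trans_lt ha⟩
  refine (hcont.continuousAt (x := y)).congr ?_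
  filter_upwards [Metric.ball_mem_nhds y (half_pos hδ)] with z hz
  simp only [Function.comp_apply, pathPointMeasure]
  rw [lintegral_atomSum]
  refine (tsum_eq_sum fun t ht => ?_).symm
  have h1 : ‖y t‖ < δ / 2 := by simpa using ht
  have h2 : dist (z t) (y t) < δ / 2 := (dist_apply_le z y t).trans_lt hz
  rw [h (z t), ENNReal.coe_zero]
  rw [dist_eq_norm] at h2
  calc ‖z t‖ = ‖(z t - y t) + y t‖ := by rw [sub_add_cancel]
    _ ≤ ‖z t - y t‖ + ‖y t‖ := norm_add_le _ _
    _ < δ := by linarith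

theorem atomSum_truncPath {d : ℕ} (S : Set ℤ) [Fintype S] (y : PathSpace d) :
    atomSum (truncPath S.toFinset y) = atomSum fun i : S => y i := by
  ext B hB
  rw [atomSum, atomSum, Measure.sum_apply _ hB, Measure.sum_apply _ hB,
    tsum_subtype S fun t => atom (y t) B]
  refine tsum_congr fun t => ?_
  by_cases ht : t ∈ S <;> simp [ht]

theorem clusterProcess_eq {Ω : Type*} {d : ℕ} (X : ℤ → Ω → Vec d) (r : ℕ) (c : ℝ) (ω : Ω) :
    clusterProcess X r c ω =
      pathPointMeasure (truncPath (Finset.Icc 1 (r : ℤ)) (c⁻¹ • fun t => X t ω)) := by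
  have h := atomSum_truncPath (Set.Icc (1 : ℤ) r) (c⁻¹ • fun t => X t ω)
  rw [Set.toFinset_Icc] at h
  rw [clusterProcess, ← toPointMeasure_toMeasure (pathPointMeasure _)]
  exact congrArg toPointMeasure h.symm

theorem clusterProcess_toMeasure {Ω : Type*} {d : ℕ} (X : ℤ → Ω → Vec d) (r : ℕ) (c : ℝ) (ω : Ω) :
    (clusterProcess X r c ω).toMeasure = atomSum fun i : Set.Icc (1 : ℤ) r => c⁻¹ • X i ω := by
  have h := atomSum_truncPath (Set.Icc (1 : ℤ) r) (c⁻¹ • fun t => X t ω)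
  rw [Set.toFinset_Icc] at h
  rw [clusterProcess_eq]
  exact h

theorem tailPointProcess_eq {Ω : Type*} {d : ℕ} (Y : ℤ → Ω → Vec d) {ω : Ω}
    (h : Tendsto (fun t => Y t ω) cofinite (𝓝 0)) :
    tailPointProcess Y ω = pathPointMeasure (toNullPath fun t => Y t ω) := by
  rw [toNullPath_of_tendsto h, tailPointProcess, ← toPointMeasure_toMeasure (pathPointMeasure _)]
  rfl

theorem tailPointProcess_toMeasure {Ω : Type*} {d : ℕ} (Y : ℤ → Ω → Vec d) {ω : Ω}
    (h : Tendsto (fun t => Y t ω) cofinite (𝓝 0)) :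
    (tailPointProcess Y ω).toMeasure = atomSum fun t => Y t ω := by
  rw [tailPointProcess_eq Y h, toNullPath_of_tendsto h]
  rfl

/-! ### Clusters of exceedances -/

/-- The times `t` with `m ≤ |t| ≤ r`. -/
def farTimes (m r : ℕ) : Finset ℤ := (Finset.Icc (-(r : ℤ)) r).filter fun t => (m : ℤ) ≤ |t|

theorem mem_farTimes {m r : ℕ} {t : ℤ} : t ∈ farTimes m r ↔ (m : ℤ) ≤ |t| ∧ |t| ≤ r := by
  simp only [farTimes, Finset.mem_filter, Finset.mem_Icc, abs_le]
  tauto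

/-- Thresholds `x n → ∞` and block lengths `r n → ∞` for which an exceedance of `x n` is unlikely
to come with large values at far away times of the block. -/
structure IsClusterSeq {d : ℕ} (N : Seminorm ℝ (Vec d)) (ν : Measure (PathSpace d)) (x : ℕ → ℝ)
    (r : ℕ → ℕ) : Prop where
  pos : ∀ n, 0 < x n
  tendsto : Tendsto x atTop atTop
  length_pos : ∀ n, 0 < r n
  length_tendsto : Tendsto r atTop atTop
  anti : ∀ ε : ℝ, 0 < ε → ε ≤ 1 → ∀ δ : ℝ, 0 < δ → ∃ m₀ : ℕ, ∀ m ≥ m₀, ∀ᶠ n in atTop,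
    ν.real (exceed N (x n) ∩ {y | ∃ t ∈ farTimes m (r n), ε * x n < N (y t)})
      ≤ δ * ν.real (exceed N (x n))

/-- An exceedance of `x` at time `0`, and none from time `s` to time `-1`. -/
def firstExceed {d : ℕ} (N : Seminorm ℝ (Vec d)) (x : ℝ) (s : ℤ) : Set (PathSpace d) :=
  exceed N x ∩ {y | ∀ t ∈ Finset.Icc s (-1), N (y t) ≤ x}

theorem measurableSet_firstExceed {d : ℕ} (N : Seminorm ℝ (Vec d)) (x : ℝ) (s : ℤ) :
    MeasurableSet (firstExceed N x s) :=
  (measurableSet_exceed N x).inter (IsTailPair.measurableSet_forall_le N (Finset.Icc s (-1)) x)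

theorem continuous_truncPath_smul {d : ℕ} (S : Finset ℤ) (c : ℝ) :
    Continuous fun y : PathSpace d => truncPath S (c • y) :=
  (continuous_truncPath S).comp (continuous_const_smul c)

namespace IsTailPair

variable {d : ℕ} {N : Seminorm ℝ (Vec d)} {α : ℝ} {ν μ : Measure (PathSpace d)} {x : ℕ → ℝ}
  {r : ℕ → ℕ}

theorem ae_one_lt (hT : IsTailPair N α ν μ) : ∀ᵐ z ∂μ, 1 < N (z 0) := by
  have := hT.prob_right
  have h := hT.pareto 1 le_rfl
  rw [Real.one_rpow] at h
  exact (prob_compl_eq_zero_iff (measurableSet_lt_apply N 1 0)).2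
    ((ENNReal.toReal_eq_one_iff _).1 h)

/-- For far times up to a fixed `R`, the probability is a limit of conditional probabilities that
the anti-clustering bound controls as soon as `r n ≥ R`. The bound does not depend on `R`, so it
survives the increasing union. -/
theorem measure_exists_far_le (hT : IsTailPair N α ν μ) (hC : IsClusterSeq N ν x r) {ε : ℝ}
    (hε : 0 < ε) (hε1 : ε ≤ 1) {δ : ℝ} (hδ : 0 < δ) :
    ∃ m : ℕ, μ {z | ∃ t : ℤ, (m : ℤ) ≤ |t| ∧ ε < N (z t)} ≤ ENNReal.ofReal δ := by
  have := hT.prob_left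
  have := hT.prob_right
  obtain ⟨m, hm⟩ := hC.anti ε hε hε1 δ hδ
  have hm := hm m le_rfl
  refine ⟨m, ?_⟩
  have e : {z : PathSpace d | ∃ t : ℤ, (m : ℤ) ≤ |t| ∧ ε < N (z t)}
      = ⋃ R : ℕ, {z | ∃ t ∈ farTimes m R, ε < N (z t)} := by
    ext z
    simp only [mem_ofPred_eq, mem_iUnion, mem_farTimes]
    constructor
    · rintro ⟨t, h1, h2⟩
      exact ⟨t.natAbs, t, ⟨h1, by simp⟩, h2⟩
    · rintro ⟨R, t, h1, h2⟩
      exact ⟨t, h1.1, h2⟩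
  have mono : Monotone fun R : ℕ => {z : PathSpace d | ∃ t ∈ farTimes m R, ε < N (z t)} := by
    rintro R R' hR z ⟨t, ht, hz⟩
    rw [mem_farTimes] at ht
    exact ⟨t, mem_farTimes.2 ⟨ht.1, ht.2.trans (by exact_mod_cast hR)⟩, hz⟩
  rw [e, mono.measure_iUnion]
  refine iSup_le fun R => ?_
  rw [ENNReal.le_ofReal_iff_toReal_le (measure_ne_top _ _) hδ.le]
  have hconv := (hT.conv_const (measurableSet_exists_lt N (farTimes m R : Set ℤ) ε)
    (hT.frontier_exists_lt_null (farTimes m R) hε)).comp hC.tendsto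
  refine le_of_tendsto hconv ?_
  filter_upwards [hm, hC.length_tendsto.eventually_ge_atTop R] with n hn hR
  simp only [Function.comp_apply]
  rw [div_le_iff₀ (hT.pos _)]
  refine (measureReal_mono ?_).trans hn
  rintro y ⟨hy, t, ht, hty⟩
  refine ⟨hy, t, ?_, ?_⟩
  · have ht := mem_farTimes.1 ht
    exact mem_farTimes.2 ⟨ht.1, ht.2.trans (by exact_mod_cast hR)⟩
  · rwa [Pi.smul_apply, seminorm_inv_smul N (hC.pos n), lt_div_iff₀ (hC.pos n)] at hty

/-- The tail process vanishes at infinity. -/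
theorem ae_tendsto_norm (hT : IsTailPair N α ν μ) (hC : IsClusterSeq N ν x r) :
    ∀ᵐ z ∂μ, Tendsto (fun t => N (z t)) cofinite (𝓝 0) := by
  have h : ∀ k : ℕ, ∀ᵐ z ∂μ, ∃ m : ℕ, ∀ t : ℤ, (m : ℤ) ≤ |t| → N (z t) ≤ 1 / ((k : ℝ) + 1) := by
    intro k
    rw [ae_iff]
    refine le_antisymm (ENNReal.le_of_forall_pos_le_add fun δ hδ _ => ?_) zero_le
    have hk : 1 / ((k : ℝ) + 1) ≤ 1 := by
      rw [div_le_one (by positivity)]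
      linarith [k.cast_nonneg (α := ℝ)]
    obtain ⟨m, hm⟩ := hT.measure_exists_far_le hC (ε := 1 / ((k : ℝ) + 1)) (by positivity) hk
      (δ := δ) (by exact_mod_cast hδ)
    rw [zero_add, ← ENNReal.ofReal_coe_nnreal]
    refine (measure_mono fun z hz => ?_).trans hm
    simp only [mem_ofPred_eq, not_exists, not_forall, not_le] at hz ⊢
    obtain ⟨t, ht, hzt⟩ := hz m
    exact ⟨t, ht, hzt⟩
  filter_upwards [ae_all_iff.2 h] with z hz
  rw [Metric.tendsto_nhds]
  intro ε hε
  obtain ⟨k, hk⟩ := exists_nat_one_div_lt hε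
  obtain ⟨m, hm⟩ := hz k
  rw [eventually_cofinite]
  refine (Finset.finite_toSet (Finset.Icc (-(m : ℤ)) m)).subset fun t ht => ?_
  by_contra hcon
  refine ht ?_
  rw [Real.dist_eq, sub_zero, abs_of_nonneg (apply_nonneg N _)]
  refine (hm t ?_).trans_lt hk
  by_contra hlt
  rw [not_le, abs_lt] at hlt
  exact hcon (by simp only [Finset.coe_Icc, mem_Icc]; omega)

theorem ae_tendsto (hT : IsTailPair N α ν μ) (hN : IsNorm N) (hC : IsClusterSeq N ν x r) :
    ∀ᵐ z ∂μ, Tendsto z cofinite (𝓝 0) := by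
  obtain ⟨C, -, hC'⟩ := hN.exists_norm_le
  filter_upwards [hT.ae_tendsto_norm hC] with z hz
  refine squeeze_zero_norm (fun t => hC' (z t)) ?_
  simpa using hz.const_mul C

theorem tendsto_real_forall_le (μ : Measure (PathSpace d)) [IsFiniteMeasure μ] :
    Tendsto (fun k : ℕ => μ.real {z | ∀ t ∈ Finset.Icc 1 (k : ℤ), N (z t) ≤ 1}) atTop
      (𝓝 (μ.real {z | ∀ t ∈ Ici (1 : ℤ), N (z t) ≤ 1})) := by
  have e : {z : PathSpace d | ∀ t ∈ Ici (1 : ℤ), N (z t) ≤ 1}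
      = ⋂ m : ℕ, {z | ∀ t ∈ Finset.Icc 1 (m : ℤ), N (z t) ≤ 1} := by
    ext z
    simp only [mem_ofPred_eq, mem_iInter, Finset.mem_Icc, mem_Ici]
    exact ⟨fun h m t ht => h t ht.1, fun h t ht => h t.natAbs t ⟨ht, by simp [le_abs_self]⟩⟩
  rw [e]
  refine (ENNReal.tendsto_toReal (measure_ne_top _ _)).comp
    (tendsto_measure_iInter_atTop
      (fun m => (measurableSet_forall_le N (Finset.Icc 1 (m : ℤ) : Finset ℤ) 1).nullMeasurableSet)
      (fun m m' hm z hz t ht => hz t ?_) ⟨0, measure_ne_top _ _⟩)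
  rw [Finset.mem_Icc] at ht ⊢
  exact ⟨ht.1, ht.2.trans (by exact_mod_cast hm)⟩

/-- The runs estimator converges. -/
theorem tendsto_runs (hT : IsTailPair N α ν μ) (hC : IsClusterSeq N ν x r) :
    Tendsto (fun n => ν.real (exceed N (x n) ∩
      {y | ∀ t ∈ Finset.Icc 1 (r n : ℤ), N (y t) ≤ x n}) / ν.real (exceed N (x n))) atTop
      (𝓝 (μ.real {z | ∀ t ∈ Ici (1 : ℤ), N (z t) ≤ 1})) := by
  have := hT.prob_left
  have := hT.prob_right
  refine tendsto_of_uniform_approx (g := fun (m : ℕ) n => ν.real (exceed N (x n) ∩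
      {y | (x n)⁻¹ • y ∈ {z : PathSpace d | ∀ t ∈ Finset.Icc 1 (m : ℤ), N (z t) ≤ 1}})
        / ν.real (exceed N (x n)))
    (b := fun m => μ.real {z | ∀ t ∈ Finset.Icc 1 (m : ℤ), N (z t) ≤ 1}) (fun m => ?_) ?_ ?_
  · exact (hT.conv_const (measurableSet_forall_le N (Finset.Icc 1 (m : ℤ) : Finset ℤ) 1)
      (hT.frontier_forall_le_null _ one_pos)).comp hC.tendsto
  · exact tendsto_real_forall_le μ
  · intro ε hε
    obtain ⟨m₀, hm₀⟩ := hC.anti 1 one_pos le_rfl ε hε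
    filter_upwards [eventually_ge_atTop m₀] with m hm
    filter_upwards [hm₀ m hm, hC.length_tendsto.eventually_ge_atTop m] with n hn hmn
    have hp := hT.pos (x n)
    rw [← sub_div, abs_div, abs_of_pos hp, div_le_iff₀ hp, abs_sub_comm]
    have hiff : ∀ (y : PathSpace d) t, N (((x n)⁻¹ • y) t) ≤ 1 ↔ N (y t) ≤ x n := fun y t => by
      rw [Pi.smul_apply, seminorm_inv_smul N (hC.pos n), div_le_one (hC.pos n)]
    simp only [hiff]
    -- The shorter window gives the larger event, and the difference requires an exceedance at a
    -- time in `(m, r n]`.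
    rw [← measureReal_sdiff, abs_of_nonneg measureReal_nonneg]
    · refine (measureReal_mono ?_).trans hn
      rintro y ⟨⟨hy, h1⟩, h2⟩
      refine ⟨hy, ?_⟩
      by_contra hcon
      simp only [mem_ofPred_eq, one_mul, not_exists, not_and, not_lt, mem_farTimes] at hcon
      refine h2 ⟨hy, fun t ht => ?_⟩
      rw [Finset.mem_Icc] at ht
      by_cases htm : t ≤ m
      · exact h1 t (Finset.mem_Icc.2 ⟨ht.1, htm⟩)
      · exact hcon t (by rw [abs_of_pos (by omega)]; omega)
    · rintro y ⟨hy, h1⟩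
      refine ⟨hy, fun t ht => h1 t ?_⟩
      rw [Finset.mem_Icc] at ht ⊢
      exact ⟨ht.1, ht.2.trans (by exact_mod_cast hmn)⟩
    · exact (measurableSet_exceed N _).inter
        (measurableSet_forall_le N (Finset.Icc 1 (r n : ℤ) : Finset ℤ) (x n))

/-- The contribution of the blocks whose first exceedance is seen from its own time, in terms of a
test function `h` on null paths. -/
def blockIntegral (N : Seminorm ℝ (Vec d)) (ν : Measure (PathSpace d)) (h : C₀(ℤ, Vec d) → ℝ)
    (x : ℝ) (s t : ℤ) : ℝ :=
  ∫ y in firstExceed N x s, h (truncPath (Finset.Icc s t) (x⁻¹ • y)) ∂ν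

theorem integrable_truncPath (hT : IsTailPair N α ν μ) {h : C₀(ℤ, Vec d) → ℝ} {B : ℝ}
    (hB : ∀ f, |h f| ≤ B) (hc : Continuous h) (S : Finset ℤ) (c : ℝ) :
    Integrable (fun y => h (truncPath S (c • y))) ν := by
  have := hT.prob_left
  exact Integrable.of_bound (hc.comp (continuous_truncPath_smul S c)).measurable.aestronglyMeasurable
    B (Eventually.of_forall fun y => hB _)

theorem abs_blockIntegral_sub_le (hT : IsTailPair N α ν μ) {h : C₀(ℤ, Vec d) → ℝ} {B : ℝ}
    (hB : ∀ f, |h f| ≤ B) (x : ℝ) (s t s' t' : ℤ) :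
    |blockIntegral N ν h x s t - blockIntegral N ν h x s' t'| ≤ 2 * B * ν.real (exceed N x) := by
  have := hT.prob_left
  have hB0 : 0 ≤ B := (abs_nonneg _).trans (hB 0)
  have key : ∀ s t, |blockIntegral N ν h x s t| ≤ B * ν.real (exceed N x) := fun s t => by
    refine (norm_setIntegral_le_of_norm_le_const (C := B)
      (f := fun y => h (truncPath (Finset.Icc s t) (x⁻¹ • y))) (measure_lt_top _ _)
      fun y _ => hB _).trans ?_
    exact mul_le_mul_of_nonneg_left (measureReal_mono inter_subset_left) hB0
  have := key s t
  have := key s' t'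
  rw [abs_le] at *
  constructor <;> linarith

/-- If all far values are at most `ε * x`, the two truncations differ by at most `C * ε` in sup
distance; and as `ε ≤ 1`, no far time is an exceedance, so both windows agree on whether `0` is the
first one. On the remaining event the crude bound `2 * B` is used. -/
theorem abs_blockIntegral_sub_le_of_far (hT : IsTailPair N α ν μ) {h : C₀(ℤ, Vec d) → ℝ} {B : ℝ}
    (hB : ∀ f, |h f| ≤ B) {L : ℝ≥0} (hL : LipschitzWith L h) {C : ℝ}
    (hC0 : 0 < C) (hC : ∀ v, ‖v‖ ≤ C * N v) {x : ℝ} (hx : 0 < x) {ε : ℝ} (hε : 0 < ε)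
    (hε1 : ε ≤ 1) {m r : ℕ} {s t : ℤ} (hs : s ≤ -m) (hs' : -r ≤ s) (ht : m ≤ t) (ht' : t ≤ r) :
    |blockIntegral N ν h x s t - blockIntegral N ν h x (-m) m|
      ≤ L * (C * ε) * ν.real (exceed N x) +
        2 * B * ν.real (exceed N x ∩ {y | ∃ t ∈ farTimes m r, ε * x < N (y t)}) := by
  have := hT.prob_left
  have hB0 : 0 ≤ B := (abs_nonneg _).trans (hB 0)
  set D : Set (PathSpace d) := exceed N x ∩ {y | ∃ t ∈ farTimes m r, ε * x < N (y t)}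
  have mD : MeasurableSet D :=
    (measurableSet_exceed N x).inter (measurableSet_exists_lt N (farTimes m r : Set ℤ) (ε * x))
  have mE := measurableSet_exceed N x
  unfold blockIntegral
  have i1 := (hT.integrable_truncPath hB hL.continuous (Finset.Icc s t) x⁻¹).indicator
    (measurableSet_firstExceed N x s)
  have i2 := (hT.integrable_truncPath hB hL.continuous (Finset.Icc (-(m : ℤ)) m) x⁻¹).indicator
    (measurableSet_firstExceed N x (-m))
  rw [← integral_indicator (measurableSet_firstExceed N x s),
    ← integral_indicator (measurableSet_firstExceed N x (-m)), ← integral_sub i1 i2]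
  have j1 : Integrable ((exceed N x).indicator fun _ => (L * (C * ε) : ℝ)) ν :=
    (integrable_const _).indicator mE
  have j2 : Integrable (D.indicator fun _ => 2 * B) ν := (integrable_const _).indicator mD
  have e : L * (C * ε) * ν.real (exceed N x) + 2 * B * ν.real D
      = ∫ y, ((exceed N x).indicator (fun _ => (L * (C * ε) : ℝ)) y +
        D.indicator (fun _ => 2 * B) y) ∂ν := by
    rw [integral_add j1 j2, integral_indicator_const _ mE, integral_indicator_const _ mD,
      smul_eq_mul, smul_eq_mul]
    ring
  rw [e]
  refine abs_integral_le_integral_abs.trans (integral_mono (i1.sub i2).abs (j1.add j2) fun y => ?_)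
  beta_reduce
  by_cases hy : y ∈ exceed N x
  swap
  · have h1 : y ∉ firstExceed N x s := fun h => hy h.1
    have h2 : y ∉ firstExceed N x (-m) := fun h => hy h.1
    have h3 : y ∉ D := fun h => hy h.1
    simp [hy, h1, h2, h3]
  rw [indicator_of_mem hy]
  have hLC : 0 ≤ L * (C * ε) := by positivity
  by_cases hyD : y ∈ D
  · rw [indicator_of_mem hyD]
    have hb : ∀ (S : Set (PathSpace d)) (g : PathSpace d → ℝ), (∀ y, |g y| ≤ B) →
        |S.indicator g y| ≤ B := fun S g hg => by
      by_cases h : y ∈ S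
      · rw [indicator_of_mem h]
        exact hg y
      · rwa [indicator_of_notMem h, abs_zero]
    refine (abs_sub _ _).trans ?_
    have := hb (firstExceed N x s) (fun y => h (truncPath (Finset.Icc s t) (x⁻¹ • y)))
      fun y => hB _
    have := hb (firstExceed N x (-m)) (fun y => h (truncPath (Finset.Icc (-m) m) (x⁻¹ • y)))
      fun y => hB _
    linarith
  · rw [indicator_of_notMem hyD, add_zero]
    have hfar : ∀ k : ℤ, (m : ℤ) ≤ |k| → |k| ≤ r → N (y k) ≤ ε * x := fun k h1 h2 =>
      not_lt.1 fun hlt => hyD ⟨hy, k, mem_farTimes.2 ⟨h1, h2⟩, hlt⟩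
    have hεx : ε * x ≤ x := by nlinarith
    have hiff : y ∈ firstExceed N x s ↔ y ∈ firstExceed N x (-m) := by
      simp only [firstExceed, mem_inter_iff, hy, true_and, mem_ofPred_eq, Finset.mem_Icc]
      refine ⟨fun h k hk => h k ⟨by omega, hk.2⟩, fun h k hk => ?_⟩
      by_cases hkm : -m ≤ k
      · exact h k ⟨hkm, hk.2⟩
      · exact (hfar k (le_abs.2 (by omega)) (abs_le.2 ⟨by omega, by omega⟩)).trans hεx
    by_cases hf : y ∈ firstExceed N x s
    · rw [indicator_of_mem hf, indicator_of_mem (hiff.1 hf), ← Real.dist_eq]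
      refine (hL.dist_le_mul _ _).trans ?_
      gcongr
      refine (dist_nullPath_le_iff (by positivity)).2 fun k => ?_
      have hk : ∀ k : ℤ, (m : ℤ) ≤ |k| → |k| ≤ r → ‖x⁻¹ • y k‖ ≤ C * ε := fun k h1 h2 => by
        refine (hC _).trans ?_
        gcongr
        rw [seminorm_inv_smul N hx, div_le_iff₀ hx]
        exact hfar k h1 h2
      simp only [truncPath_apply, Finset.mem_Icc, Pi.smul_apply]
      by_cases h1 : -(m : ℤ) ≤ k ∧ k ≤ m
      · have h2 : s ≤ k ∧ k ≤ t := ⟨by omega, by omega⟩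
        simp only [h1, h2, and_self, if_true, dist_self]
        positivity
      · by_cases h2 : s ≤ k ∧ k ≤ t
        · simp only [h1, h2, and_self, if_true, if_false, dist_zero_right]
          refine hk k (le_abs.2 (by omega)) (abs_le.2 ⟨by omega, by omega⟩)
        · simp only [h1, h2, if_false, dist_self]
          positivity
    · rw [indicator_of_notMem hf, indicator_of_notMem fun h => hf (hiff.2 h)]
      simpa using hLC

/-- For the positions not counted here, the recentred block `[1 - i, r - i]` contains `[-m, m]`. -/
theorem card_edge_le (m r : ℕ) :
    ((Finset.Icc 1 (r : ℤ)).filter fun i => ¬ ((m : ℤ) + 1 ≤ i ∧ i ≤ r - m)).card ≤ 2 * m := by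
  refine (Finset.card_le_card (t := Finset.Icc 1 (m : ℤ) ∪ Finset.Icc (r - m + 1) (r : ℤ))
    fun i hi => ?_).trans ((Finset.card_union_le _ _).trans ?_)
  · simp only [Finset.mem_filter, Finset.mem_Icc, Finset.mem_union] at hi ⊢
    omega
  · simp only [Int.card_Icc]
    omega

theorem tendsto_blockIntegral_window (hT : IsTailPair N α ν μ) (hC : IsClusterSeq N ν x r)
    {h : C₀(ℤ, Vec d) → ℝ} {B : ℝ} (hB : ∀ f, |h f| ≤ B) (hc : Continuous h) (m : ℕ) :
    Tendsto (fun n => blockIntegral N ν h (x n) (-m) m / ν.real (exceed N (x n))) atTop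
      (𝓝 (∫ z in {z | ∀ t ∈ Finset.Icc (-(m : ℤ)) (-1), N (z t) ≤ 1},
        h (truncPath (Finset.Icc (-(m : ℤ)) m) z) ∂μ)) := by
  have hcc : Continuous fun z : PathSpace d => h (truncPath (Finset.Icc (-(m : ℤ)) m) z) :=
    hc.comp (continuous_truncPath _)
  have := (hT.conv (BoundedContinuousFunction.ofNormedAddCommGroup _ hcc B fun z => hB _)
    {z | ∀ t ∈ Finset.Icc (-(m : ℤ)) (-1), N (z t) ≤ 1}
    (measurableSet_forall_le N (Finset.Icc (-(m : ℤ)) (-1) : Finset ℤ) 1)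
    (hT.frontier_forall_le_null _ one_pos)).comp hC.tendsto
  refine this.congr fun n => ?_
  have e : {y : PathSpace d | (x n)⁻¹ • y ∈
      {z : PathSpace d | ∀ t ∈ Finset.Icc (-(m : ℤ)) (-1), N (z t) ≤ 1}}
      = {y | ∀ t ∈ Finset.Icc (-(m : ℤ)) (-1), N (y t) ≤ x n} := by
    ext y
    simp only [mem_ofPred_eq, Pi.smul_apply, seminorm_inv_smul N (hC.pos n),
      div_le_one (hC.pos n)]
  simp only [Function.comp_apply, e]
  rfl

/-- Dominated convergence; the truncations converge in `C₀` because almost every path is null. -/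
theorem tendsto_window_limit (hT : IsTailPair N α ν μ) (hN : IsNorm N) (hC : IsClusterSeq N ν x r)
    {h : C₀(ℤ, Vec d) → ℝ} {B : ℝ} (hB : ∀ f, |h f| ≤ B) (hc : Continuous h) :
    Tendsto (fun m : ℕ => ∫ z in {z | ∀ t ∈ Finset.Icc (-(m : ℤ)) (-1), N (z t) ≤ 1},
        h (truncPath (Finset.Icc (-(m : ℤ)) m) z) ∂μ) atTop
      (𝓝 (∫ z in {z | ∀ t ∈ Iio (0 : ℤ), N (z t) ≤ 1}, h (toNullPath z) ∂μ)) := by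
  have := hT.prob_right
  have hB0 : 0 ≤ B := (abs_nonneg _).trans (hB 0)
  have mA : ∀ m : ℕ, MeasurableSet
      {z : PathSpace d | ∀ t ∈ Finset.Icc (-(m : ℤ)) (-1), N (z t) ≤ 1} := fun m =>
    measurableSet_forall_le N (Finset.Icc (-(m : ℤ)) (-1) : Finset ℤ) 1
  rw [← integral_indicator (measurableSet_forall_le N (Iio (0 : ℤ)) 1)]
  simp_rw [← integral_indicator (mA _)]
  refine tendsto_integral_of_dominated_convergence (fun _ => B) (fun m => ?_) (integrable_const B)
    (fun m => Eventually.of_forall fun z => ?_) ?_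
  · exact ((hc.comp (continuous_truncPath _)).measurable.indicator (mA m)).aestronglyMeasurable
  · refine (norm_indicator_le_norm_self _ z).trans (hB _)
  · filter_upwards [hT.ae_tendsto hN hC] with z hz
    by_cases hA : z ∈ {z : PathSpace d | ∀ t ∈ Iio (0 : ℤ), N (z t) ≤ 1}
    · rw [indicator_of_mem hA, toNullPath_of_tendsto hz]
      refine ((hc.tendsto _).comp (tendsto_truncPath hz)).congr fun m => ?_
      rw [indicator_of_mem]
      · rfl
      · exact fun t ht => hA t (by rw [Finset.mem_Icc] at ht; simp only [mem_Iio]; omega)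
    · rw [indicator_of_notMem hA]
      simp only [mem_ofPred_eq, not_forall, not_le] at hA
      obtain ⟨t, ht, hzt⟩ := hA
      refine tendsto_const_nhds.congr' ?_
      filter_upwards [eventually_ge_atTop t.natAbs] with m hm
      rw [indicator_of_notMem]
      intro hmem
      have ht : t < 0 := ht
      exact not_lt.2 (hmem t (Finset.mem_Icc.2 ⟨by omega, by omega⟩)) hzt

/-- The blocks limit: averages over the position of the first exceedance in the block. -/
theorem tendsto_sum_blockIntegral (hT : IsTailPair N α ν μ) (hN : IsNorm N)
    (hC : IsClusterSeq N ν x r) {h : C₀(ℤ, Vec d) → ℝ} {B : ℝ} (hB : ∀ f, |h f| ≤ B) {L : ℝ≥0}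
    (hL : LipschitzWith L h) :
    Tendsto (fun n => (∑ i ∈ Finset.Icc 1 (r n : ℤ), blockIntegral N ν h (x n) (1 - i) (r n - i)) /
        (r n * ν.real (exceed N (x n)))) atTop
      (𝓝 (∫ z in {z | ∀ t ∈ Iio (0 : ℤ), N (z t) ≤ 1}, h (toNullPath z) ∂μ)) := by
  have hB0 : 0 ≤ B := (abs_nonneg _).trans (hB 0)
  obtain ⟨C, hC0, hCN⟩ := hN.exists_norm_le
  refine tendsto_of_uniform_approx
    (fun m => hT.tendsto_blockIntegral_window hC hB hL.continuous m)
    (hT.tendsto_window_limit hN hC hB hL.continuous) fun η hη => ?_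
  -- The error `η` has three equal shares: the Lipschitz error from small far values (`ε`), the
  -- event of large far values (`δ`), and the at most `2 * m` positions near the ends of the block.
  -- The `+ 1` in the denominators allows `L = 0` and `B = 0`.
  obtain ⟨ε, hε, hε1, hεη⟩ : ∃ ε : ℝ, 0 < ε ∧ ε ≤ 1 ∧ L * (C * ε) ≤ η / 3 := by
    refine ⟨min 1 (η / (3 * (L * C + 1))), by positivity, min_le_left _ _, ?_⟩
    calc (L : ℝ) * (C * min 1 (η / (3 * (L * C + 1))))
        ≤ (L * C + 1) * (η / (3 * (L * C + 1))) := by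
          rw [← mul_assoc]
          gcongr
          · linarith
          · exact min_le_right _ _
      _ = η / 3 := by field_simp
  obtain ⟨δ, hδ, hδη⟩ : ∃ δ : ℝ, 0 < δ ∧ 2 * B * δ ≤ η / 3 := by
    refine ⟨η / (3 * (2 * B + 1)), by positivity, ?_⟩
    calc 2 * B * (η / (3 * (2 * B + 1))) ≤ (2 * B + 1) * (η / (3 * (2 * B + 1))) := by
          gcongr
          linarith
      _ = η / 3 := by field_simp
  obtain ⟨m₀, hm₀⟩ := hC.anti ε hε hε1 δ hδ
  filter_upwards [eventually_ge_atTop m₀] with m hm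
  have hr : Tendsto (fun n => 2 * m * (2 * B) / (r n : ℝ)) atTop (𝓝 0) :=
    tendsto_const_nhds.div_atTop (tendsto_natCast_atTop_atTop.comp hC.length_tendsto)
  filter_upwards [hm₀ m hm, hr.eventually_lt_const (show 0 < η / 3 by positivity)] with n hn hrn
  set p := ν.real (exceed N (x n))
  have hp : 0 < p := hT.pos (x n)
  have hr0 : (0 : ℝ) < r n := by exact_mod_cast hC.length_pos n
  set I := blockIntegral N ν h (x n) (-m) m
  have hterm : ∀ i ∈ Finset.Icc 1 (r n : ℤ),
      |blockIntegral N ν h (x n) (1 - i) (r n - i) - I| ≤ (2 * η / 3) * p +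
        if ¬ ((m : ℤ) + 1 ≤ i ∧ i ≤ r n - m) then 2 * B * p else 0 := by
    intro i hi
    rw [Finset.mem_Icc] at hi
    split_ifs with hg
    · rw [add_zero]
      refine (hT.abs_blockIntegral_sub_le_of_far hB hL hC0 hCN (hC.pos n) hε hε1 (m := m)
        (r := r n) (by omega) (by omega) (by omega) (by omega)).trans ?_
      calc _ ≤ η / 3 * p + 2 * B * (δ * p) := by gcongr
        _ ≤ η / 3 * p + η / 3 * p := by
          rw [← mul_assoc]
          gcongr
        _ = _ := by ring
    · refine (hT.abs_blockIntegral_sub_le hB _ _ _ _ _).trans ?_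
      have : 0 ≤ 2 * η / 3 * p := by positivity
      linarith
  have hsum : |∑ i ∈ Finset.Icc 1 (r n : ℤ), blockIntegral N ν h (x n) (1 - i) (r n - i) -
      r n * I| ≤ r n * (2 * η / 3 * p) + 2 * m * (2 * B * p) := by
    have e : (r n : ℝ) * I = ∑ i ∈ Finset.Icc 1 (r n : ℤ), I := by simp
    rw [e, ← Finset.sum_sub_distrib]
    refine (Finset.abs_sum_le_sum_abs _ _).trans ((Finset.sum_le_sum hterm).trans ?_)
    rw [Finset.sum_add_distrib, ← Finset.sum_filter, Finset.sum_const, Finset.sum_const,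
      nsmul_eq_mul, nsmul_eq_mul]
    have hcard : (((Finset.Icc 1 (r n : ℤ)).filter fun i =>
        ¬ ((m : ℤ) + 1 ≤ i ∧ i ≤ r n - m)).card : ℝ) ≤ 2 * m := by
      exact_mod_cast card_edge_le m (r n)
    gcongr
    simp
  have e : (∑ i ∈ Finset.Icc 1 (r n : ℤ), blockIntegral N ν h (x n) (1 - i) (r n - i)) /
      (r n * p) - I / p = (∑ i ∈ Finset.Icc 1 (r n : ℤ),
        blockIntegral N ν h (x n) (1 - i) (r n - i) - r n * I) / (r n * p) := by
    field_simp
  rw [e, abs_div, abs_of_pos (by positivity : 0 < r n * p), div_le_iff₀ (by positivity)]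
  refine hsum.trans ?_
  rw [div_lt_iff₀ hr0] at hrn
  nlinarith

end IsTailPair

/-! ### Blocks decomposed at their first exceedance -/

namespace IsTailPair

variable {d : ℕ} {N : Seminorm ℝ (Vec d)} {α : ℝ} {ν μ : Measure (PathSpace d)} {x : ℕ → ℝ}
  {r : ℕ → ℕ}

/-- Decomposition of a block with an exceedance at its first exceedance. -/
theorem setIntegral_exists_eq_sum (hT : IsTailPair N α ν μ) {G : PathSpace d → ℝ}
    (hG : Measurable G) {B : ℝ} (hB : ∀ y, |G y| ≤ B) (x : ℝ) (r : ℕ) :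
    ∫ y in {y | ∃ t ∈ Finset.Icc 1 (r : ℤ), x < N (y t)}, G y ∂ν
      = ∑ i ∈ Finset.Icc 1 (r : ℤ), ∫ y in firstExceed N x (1 - i), G (shiftPath (-i) y) ∂ν := by
  have := hT.prob_left
  have mU : ∀ i : ℤ, MeasurableSet (shiftPath i ⁻¹' firstExceed N x (1 - i)) := fun i =>
    measurable_shiftPath i (measurableSet_firstExceed N x _)
  have hmem : ∀ (i : ℤ) (y : PathSpace d), y ∈ shiftPath i ⁻¹' firstExceed N x (1 - i) ↔
      x < N (y i) ∧ ∀ t, 1 ≤ t → t < i → N (y t) ≤ x := fun i y => by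
    simp only [firstExceed, exceed, mem_preimage, mem_inter_iff, mem_ofPred_eq, shiftPath_apply,
      zero_add, Finset.mem_Icc]
    refine and_congr_right fun _ => ⟨fun h t h1 h2 => ?_, fun h t ht => h _ (by omega) (by omega)⟩
    have := h (t - i) ⟨by omega, by omega⟩
    rwa [sub_add_cancel] at this
  have e : {y : PathSpace d | ∃ t ∈ Finset.Icc 1 (r : ℤ), x < N (y t)}
      = ⋃ i ∈ Finset.Icc 1 (r : ℤ), shiftPath i ⁻¹' firstExceed N x (1 - i) := by
    ext y
    simp only [mem_iUnion, hmem, exists_prop]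
    constructor
    · intro h
      have hne : ((Finset.Icc 1 (r : ℤ)).filter fun t => x < N (y t)).Nonempty := by
        obtain ⟨t, ht, hy⟩ := h
        exact ⟨t, Finset.mem_filter.2 ⟨ht, hy⟩⟩
      obtain ⟨i, hi, hmin⟩ := Finset.exists_min_image _ id hne
      rw [Finset.mem_filter] at hi
      refine ⟨i, hi.1, hi.2, fun t h1 h2 => not_lt.1 fun hlt => ?_⟩
      have hi1 := Finset.mem_Icc.1 hi.1
      have := hmin t (Finset.mem_filter.2 ⟨Finset.mem_Icc.2 ⟨h1, by omega⟩, hlt⟩)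
      exact not_lt.2 this h2
    · rintro ⟨i, hi, h, -⟩
      exact ⟨i, hi, h⟩
  have hint : Integrable G ν :=
    Integrable.of_bound hG.aestronglyMeasurable B (Eventually.of_forall hB)
  rw [e, integral_biUnion_finset _ (fun i _ => mU i) ?_ fun i _ => hint.integrableOn]
  · refine Finset.sum_congr rfl fun i _ => ?_
    rw [← integral_indicator (mU i), ← integral_indicator (measurableSet_firstExceed N x _)]
    have hg : Measurable fun y : PathSpace d => G (shiftPath (-i) y) :=
      hG.comp (measurable_shiftPath _)
    -- Stationarity moves the first exceedance from time `i` to time `0`; shifting the argument of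
    -- `G` by `-i` compensates.
    rw [← hT.integral_shift i (hg.indicator (measurableSet_firstExceed N x _))]
    refine integral_congr_ae (Eventually.of_forall fun y => ?_)
    simp only [indicator, shiftPath_shiftPath, neg_add_cancel, shiftPath_zero]
    rfl
  · intro i hi j hj hij
    refine Set.disjoint_left.2 fun y h1 h2 => ?_
    rw [hmem] at h1 h2
    have hi := Finset.mem_Icc.1 hi
    have hj := Finset.mem_Icc.1 hj
    rcases lt_or_gt_of_ne hij with h | h
    · exact not_lt.2 (h2.2 i hi.1 h) h1.1
    · exact not_lt.2 (h1.2 j hj.1 h) h2.1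

theorem real_exists_eq_sum (hT : IsTailPair N α ν μ) (x : ℝ) (r : ℕ) :
    ν.real {y | ∃ t ∈ Finset.Icc 1 (r : ℤ), x < N (y t)}
      = ∑ i ∈ Finset.Icc 1 (r : ℤ), ν.real (firstExceed N x (1 - i)) := by
  simpa using hT.setIntegral_exists_eq_sum (G := fun _ => 1) measurable_const (B := 1)
    (fun _ => by simp) x r

theorem real_exists_pos (hT : IsTailPair N α ν μ) (x : ℝ) {r : ℕ} (hr : 0 < r) :
    0 < ν.real {y | ∃ t ∈ Finset.Icc 1 (r : ℤ), x < N (y t)} := by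
  have := hT.prob_left
  refine (hT.pos x).trans_le ?_
  rw [← hT.real_lt_apply x 1]
  exact measureReal_mono fun y hy => ⟨1, Finset.mem_Icc.2 ⟨le_rfl, by omega⟩, hy⟩

/-- The blocks estimator converges. -/
theorem tendsto_blocks (hT : IsTailPair N α ν μ) (hN : IsNorm N) (hC : IsClusterSeq N ν x r) :
    Tendsto (fun n => ν.real {y | ∃ t ∈ Finset.Icc 1 (r n : ℤ), x n < N (y t)} /
      (r n * ν.real (exceed N (x n)))) atTop
      (𝓝 (μ.real {z | ∀ t ∈ Iio (0 : ℤ), N (z t) ≤ 1})) := by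
  have := hT.tendsto_sum_blockIntegral hN hC (h := fun _ => 1) (B := 1) (by simp) (L := 0)
    (LipschitzWith.const 1)
  simp only [hT.real_exists_eq_sum]
  simpa [blockIntegral] using this

/-- The law of the block around its first exceedance, given that there is an exceedance. -/
def blockLaw (N : Seminorm ℝ (Vec d)) (ν : Measure (PathSpace d)) (x : ℝ) (r : ℕ) :
    Measure C₀(ℤ, Vec d) :=
  (ν {y | ∃ t ∈ Finset.Icc 1 (r : ℤ), x < N (y t)})⁻¹ • ∑ i ∈ Finset.Icc 1 (r : ℤ),
    (ν.restrict (firstExceed N x (1 - i))).map fun y =>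
      truncPath (Finset.Icc (1 - i) (r - i)) (x⁻¹ • y)

theorem integral_blockLaw (hT : IsTailPair N α ν μ) {h : C₀(ℤ, Vec d) → ℝ} {B : ℝ}
    (hB : ∀ f, |h f| ≤ B) (hc : Continuous h) (x : ℝ) (r : ℕ) :
    ∫ f, h f ∂(blockLaw N ν x r)
      = (∑ i ∈ Finset.Icc 1 (r : ℤ), blockIntegral N ν h x (1 - i) (r - i)) /
        ν.real {y | ∃ t ∈ Finset.Icc 1 (r : ℤ), x < N (y t)} := by
  have := hT.prob_left
  rw [blockLaw, integral_smul_measure, ENNReal.toReal_inv, smul_eq_mul, ← div_eq_inv_mul,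
    integral_finsetSum_measure]
  · congr 1
    refine Finset.sum_congr rfl fun i _ => ?_
    rw [integral_map (continuous_truncPath_smul _ _).measurable.aemeasurable
      hc.measurable.aestronglyMeasurable]
    rfl
  · exact fun i _ => Integrable.of_bound hc.measurable.aestronglyMeasurable B
      (Eventually.of_forall hB)

theorem isProbabilityMeasure_blockLaw (hT : IsTailPair N α ν μ) (x : ℝ) {r : ℕ} (hr : 0 < r) :
    IsProbabilityMeasure (blockLaw N ν x r) := by
  have := hT.prob_left
  have hpos := hT.real_exists_pos x hr
  have hsum : ∑ i ∈ Finset.Icc 1 (r : ℤ), ν (firstExceed N x (1 - i))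
      = ν {y | ∃ t ∈ Finset.Icc 1 (r : ℤ), x < N (y t)} := by
    refine (ENNReal.toReal_eq_toReal_iff' (ENNReal.sum_ne_top.2 fun i _ => measure_ne_top _ _)
      (measure_ne_top _ _)).1 ?_
    rw [ENNReal.toReal_sum fun i _ => measure_ne_top _ _]
    exact (hT.real_exists_eq_sum x r).symm
  refine ⟨?_⟩
  rw [blockLaw, Measure.smul_apply, Measure.finsetSum_apply]
  simp only [Measure.map_apply (continuous_truncPath_smul _ _).measurable MeasurableSet.univ,
    preimage_univ, Measure.restrict_apply_univ, hsum, smul_eq_mul]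
  refine ENNReal.inv_mul_cancel (fun h0 => ?_) (measure_ne_top _ _)
  rw [Measure.real, h0] at hpos
  simp at hpos

/-- The block around its first exceedance converges in law to the tail process, given that the
latter does not exceed level `1` at negative times. -/
theorem tendsto_integral_blockLaw (hT : IsTailPair N α ν μ) (hN : IsNorm N)
    (hC : IsClusterSeq N ν x r) (h : C₀(ℤ, Vec d) →ᵇ ℝ) :
    Tendsto (fun n => ∫ f, h f ∂(blockLaw N ν (x n) (r n))) atTop
      (𝓝 ((∫ z in {z | ∀ t ∈ Iio (0 : ℤ), N (z t) ≤ 1}, h (toNullPath z) ∂μ) /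
        μ.real {z | ∀ t ∈ Iio (0 : ℤ), N (z t) ≤ 1})) := by
  have := hT.prob_right
  set A : Set (PathSpace d) := {z | ∀ t ∈ Iio (0 : ℤ), N (z t) ≤ 1}
  have hApos : 0 < μ A := (isAnchor_firstExceedance (hT.ae_tendsto_norm hC) hT.ae_one_lt).measure_pos
    hT
  have hAreal : 0 < μ.real A := ENNReal.toReal_pos hApos.ne' (measure_ne_top _ _)
  have hcond : IsProbabilityMeasure (μ[|A]) := cond_isProbabilityMeasure hApos.ne'
  let lim : ProbabilityMeasure C₀(ℤ, Vec d) := ⟨(μ[|A]).map toNullPath,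
    Measure.isProbabilityMeasure_map measurable_toNullPath.aemeasurable⟩
  let law : ℕ → ProbabilityMeasure C₀(ℤ, Vec d) := fun n =>
    ⟨blockLaw N ν (x n) (r n), hT.isProbabilityMeasure_blockLaw (x n) (hC.length_pos n)⟩
  have hlim : ∀ g : C₀(ℤ, Vec d) → ℝ, Continuous g →
      ∫ f, g f ∂(lim : Measure C₀(ℤ, Vec d)) = (∫ z in A, g (toNullPath z) ∂μ) / μ.real A :=
    fun g hg => by
      rw [← integral_cond]
      exact integral_map measurable_toNullPath.aemeasurable hg.measurable.aestronglyMeasurable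
  have hconv : Tendsto law atTop (𝓝 lim) := by
    -- The averaging argument needs a Lipschitz test function. Such functions determine weak
    -- convergence, which then covers all bounded continuous ones, in particular functions of the
    -- point measure.
    rw [tendsto_iff_forall_lipschitz_integral_tendsto]
    rintro g ⟨C, hCg⟩ ⟨L, hL⟩
    have hB : ∀ f, |g f| ≤ C + |g 0| := fun f => by
      have := hCg f 0
      rw [Real.dist_eq] at this
      have e : g f = (g f - g 0) + g 0 := by ring
      rw [e]
      exact (abs_add_le _ _).trans (by linarith)
    rw [hlim g hL.continuous]
    -- Both limits are normalized by the same `r n * ν.real (exceed N (x n))`, which cancels in the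
    -- quotient; the limiting denominator is positive by anchoring.
    have h1 := (hT.tendsto_sum_blockIntegral hN hC hB hL).div (hT.tendsto_blocks hN hC) hAreal.ne'
    refine h1.congr fun n => ?_
    refine Eq.trans ?_ (hT.integral_blockLaw hB hL.continuous (x n) (r n)).symm
    have := hT.pos (x n)
    have hr0 : (0 : ℝ) < r n := by exact_mod_cast hC.length_pos n
    simp only [Pi.div_apply]
    rw [div_div_div_cancel_right₀ (by positivity)]
  have := ProbabilityMeasure.tendsto_iff_forall_integral_tendsto.1 hconv h
  rwa [hlim h h.continuous] at this

theorem measurable_pathPointMeasure_toNullPath :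
    Measurable fun z : PathSpace d => pathPointMeasure (toNullPath z) :=
  continuous_pathPointMeasure.measurable.comp measurable_toNullPath

theorem continuous_comp_pathPointMeasure (F : PointMeasure d →ᵇ ℝ) :
    Continuous fun f : C₀(ℤ, Vec d) => F (pathPointMeasure f) :=
  F.continuous.comp continuous_pathPointMeasure

/-- Recentring a block at its first exceedance does not change its point measure, so the pieces
reassemble into one integral over the original block. -/
theorem sum_blockIntegral_pathPointMeasure (hT : IsTailPair N α ν μ) (F : PointMeasure d →ᵇ ℝ)
    (x : ℝ) (r : ℕ) :
    ∑ i ∈ Finset.Icc 1 (r : ℤ),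
        blockIntegral N ν (fun f => F (pathPointMeasure f)) x (1 - i) (r - i)
      = ∫ y in {y | ∃ t ∈ Finset.Icc 1 (r : ℤ), x < N (y t)},
        F (pathPointMeasure (truncPath (Finset.Icc 1 (r : ℤ)) (x⁻¹ • y))) ∂ν := by
  have hG : Continuous fun y : PathSpace d =>
      F (pathPointMeasure (truncPath (Finset.Icc 1 (r : ℤ)) (x⁻¹ • y))) :=
    (continuous_comp_pathPointMeasure F).comp (continuous_truncPath_smul _ _)
  rw [hT.setIntegral_exists_eq_sum hG.measurable (fun y => F.norm_coe_le_norm _)]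
  refine Finset.sum_congr rfl fun i _ => integral_congr_ae (Eventually.of_forall fun y => ?_)
  have h := pathPointMeasure_truncPath_shiftPath 1 r i (x⁻¹ • shiftPath (-i) y)
  have e : shiftPath i (x⁻¹ • shiftPath (-i) y) = x⁻¹ • y := by
    funext t
    simp
  rw [e] at h
  exact congrArg F h

/-- The cluster point process converges in law. -/
theorem tendsto_cluster (hT : IsTailPair N α ν μ) (hN : IsNorm N) (hC : IsClusterSeq N ν x r)
    (F : PointMeasure d →ᵇ ℝ) :
    Tendsto (fun n => (∫ y in {y | ∃ t ∈ Finset.Icc 1 (r n : ℤ), x n < N (y t)},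
        F (pathPointMeasure (truncPath (Finset.Icc 1 (r n : ℤ)) ((x n)⁻¹ • y))) ∂ν) /
        ν.real {y | ∃ t ∈ Finset.Icc 1 (r n : ℤ), x n < N (y t)}) atTop
      (𝓝 ((∫ z in firstMaxPaths N, F (pathPointMeasure (toNullPath z)) ∂μ) /
        μ.real (firstMaxPaths N))) := by
  have hA := isAnchor_firstExceedance (hT.ae_tendsto_norm hC) hT.ae_one_lt
  have hE := isAnchor_firstMaxPaths (hT.ae_tendsto_norm hC) hT.ae_one_lt
  have hlim := hT.tendsto_integral_blockLaw hN hC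
    (F.compContinuous ⟨_, continuous_pathPointMeasure⟩)
  -- The limit found so far is anchored at the first exceedance; the shift-invariance of the point
  -- measure allows the first maximum instead.
  have e1 : ∫ z in {z | ∀ t ∈ Iio (0 : ℤ), N (z t) ≤ 1}, F (pathPointMeasure (toNullPath z)) ∂μ
      = ∫ z in firstMaxPaths N, F (pathPointMeasure (toNullPath z)) ∂μ := by
    have h := IsAnchor.map_restrict_eq hT hA hE measurable_pathPointMeasure_toNullPath
      pathPointMeasure_toNullPath_shiftPath
    have hm : ∀ A : Set (PathSpace d), ∫ z in A, F (pathPointMeasure (toNullPath z)) ∂μ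
        = ∫ w, F w ∂((μ.restrict A).map fun z => pathPointMeasure (toNullPath z)) := fun A =>
      (integral_map measurable_pathPointMeasure_toNullPath.aemeasurable
        F.continuous.measurable.aestronglyMeasurable).symm
    rw [hm, hm, h]
  have e2 : μ.real {z | ∀ t ∈ Iio (0 : ℤ), N (z t) ≤ 1} = μ.real (firstMaxPaths N) :=
    congrArg ENNReal.toReal (IsAnchor.measure_eq hT hA hE)
  simp only [BoundedContinuousFunction.compContinuous_apply, ContinuousMap.coe_mk, e1, e2] at hlim
  refine hlim.congr fun n => ?_
  rw [← hT.sum_blockIntegral_pathPointMeasure F]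
  exact hT.integral_blockLaw (fun f => F.norm_coe_le_norm _)
    (continuous_comp_pathPointMeasure F) (x n) (r n)

end IsTailPair

/-! ### From path space to the processes -/

theorem real_cond_apply {S : Type*} [MeasurableSpace S] (ρ : Measure S) {A : Set S}
    (hA : MeasurableSet A) (B : Set S) : (ρ[|A]).real B = (ρ.real A)⁻¹ * ρ.real (A ∩ B) := by
  rw [Measure.real, cond_apply hA, ENNReal.toReal_mul, ENNReal.toReal_inv]
  rfl

/-- Nonnegativity of `c` is needed because the maximum over an empty set of times is `0`. -/
theorem lt_maxNorm_iff {d : ℕ} (N : Seminorm ℝ (Vec d)) (s : Finset ℤ) (y : ℤ → Vec d) {c : ℝ}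
    (hc : 0 ≤ c) : c < maxNorm N s y ↔ ∃ t ∈ s, c < N (y t) := by
  lift c to ℝ≥0 using hc
  simp only [maxNorm, NNReal.coe_lt_coe, Finset.lt_sup_iff, Real.lt_toNNReal_iff_coe_lt]

theorem maxNorm_le_iff {d : ℕ} (N : Seminorm ℝ (Vec d)) (s : Finset ℤ) (y : ℤ → Vec d) {c : ℝ}
    (hc : 0 ≤ c) : maxNorm N s y ≤ c ↔ ∀ t ∈ s, N (y t) ≤ c := by
  rw [← not_lt, lt_maxNorm_iff N s y hc]
  simp

namespace IsTailPair

variable {d : ℕ} {N : Seminorm ℝ (Vec d)} {α : ℝ} {ν μ : Measure (PathSpace d)}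

/-- Every level `K` is exceeded with positive probability, so `a n < K` forces `n * ν.real (exceed N
(a n))` above `2` for large `n`. -/
theorem tendsto_atTop_of_tendsto_mul (hT : IsTailPair N α ν μ) {a : ℕ → ℝ}
    (ha : Tendsto (fun n : ℕ => (n : ℝ) * ν.real (exceed N (a n))) atTop (𝓝 1)) :
    Tendsto a atTop atTop := by
  have := hT.prob_left
  rw [tendsto_atTop]
  intro K
  have hK := hT.pos K
  have h1 : Tendsto (fun n : ℕ => (n : ℝ) * ν.real (exceed N K)) atTop atTop :=
    tendsto_natCast_atTop_atTop.atTop_mul_const hK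
  filter_upwards [ha.eventually_lt_const one_lt_two, h1.eventually_ge_atTop 2] with n h2 h3
  by_contra hcon
  have : ν.real (exceed N K) ≤ ν.real (exceed N (a n)) :=
    measureReal_mono fun y (hy : K < N (y 0)) => (not_le.1 hcon).trans hy
  have := mul_le_mul_of_nonneg_left this (n.cast_nonneg (α := ℝ))
  linarith

/-- The probability of a far away exceedance of a lower level. -/
theorem eventually_far_le (hT : IsTailPair N α ν μ) {x : ℕ → ℝ} (hx : Tendsto x atTop atTop)
    {r : ℕ → ℕ} {ε : ℝ} (hε : 0 < ε) (hε1 : ε ≤ 1) (hxpos : ∀ n, 0 < x n)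
    (h : Tendsto (fun m : ℕ => limsup (fun n : ℕ => (ν[|exceed N (ε * x n)])
      {y | ∃ t ∈ farTimes m (r n), ε * x n < N (y t)}) atTop) atTop (𝓝 0)) {δ : ℝ} (hδ : 0 < δ) :
    ∃ m₀ : ℕ, ∀ m ≥ m₀, ∀ᶠ n in atTop,
      ν.real (exceed N (x n) ∩ {y | ∃ t ∈ farTimes m (r n), ε * x n < N (y t)})
        ≤ δ * ν.real (exceed N (x n)) := by
  have := hT.prob_left
  -- An eventual bound for `P(N(X_0) > ε x) / P(N(X_0) > x)`: the price of lowering the conditioning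
  -- level from `x` to `ε * x`, so that it matches the level of the far values.
  set κ := ε ^ (-α) + 1
  have hκ : 0 < κ := by positivity
  have hδκ : 0 < δ / κ := by positivity
  obtain ⟨m₀, hm₀⟩ := eventually_atTop.1
    (h.eventually_lt_const (show (0 : ℝ≥0∞) < ENNReal.ofReal (δ / κ) by simpa using hδκ))
  refine ⟨m₀, fun m hm => ?_⟩
  have hratio := ((hT.tendsto_ratio hε).comp hx).eventually_lt_const
    (show ε ^ (-α) < κ by simp [κ])
  filter_upwards [eventually_lt_of_limsup_lt (hm₀ m hm), hratio] with n hn hrat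
  simp only [Function.comp_apply] at hrat
  rw [div_lt_iff₀ (hT.pos _)] at hrat
  rw [ENNReal.lt_ofReal_iff_toReal_lt (measure_ne_top _ _)] at hn
  change (ν[|exceed N (ε * x n)]).real _ < _ at hn
  rw [real_cond_apply _ (measurableSet_exceed N _), inv_mul_lt_iff₀ (hT.pos _)] at hn
  calc ν.real (exceed N (x n) ∩ {y | ∃ t ∈ farTimes m (r n), ε * x n < N (y t)})
      ≤ ν.real (exceed N (ε * x n) ∩ {y | ∃ t ∈ farTimes m (r n), ε * x n < N (y t)}) := by
        refine measureReal_mono (inter_subset_inter_left _ fun y (hy : x n < N (y 0)) => ?_)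
        have := hxpos n
        show ε * x n < N (y 0)
        nlinarith
    _ ≤ ν.real (exceed N (ε * x n)) * (δ / κ) := hn.le
    _ ≤ κ * ν.real (exceed N (x n)) * (δ / κ) := by gcongr
    _ = δ * ν.real (exceed N (x n)) := by field_simp

end IsTailPair

theorem FiniteCluster.isClusterSeq {Ω : Type*} [MeasurableSpace Ω] {d : ℕ}
    {N : Seminorm ℝ (Vec d)} {α : ℝ} {P : Measure Ω} {X : ℤ → Ω → Vec d}
    (hXm : ∀ t, Measurable (X t)) {μ : Measure (PathSpace d)} {a : ℕ → ℝ} {r : ℕ → ℕ}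
    (hr : FiniteCluster N P X a r) (ha : ∀ n, 0 < a n)
    (han : Tendsto (fun n : ℕ => (n : ℝ) * P.real {ω | a n < N (X 0 ω)}) atTop (𝓝 1))
    (hT : IsTailPair N α (P.map fun ω t => X t ω) μ) {u : ℝ} (hu : 0 < u) :
    IsClusterSeq N (P.map fun ω t => X t ω) (fun n => a n * u) r := by
  have mX : Measurable fun ω t => X t ω := measurable_pi_lambda _ hXm
  have ha' : Tendsto a atTop atTop := by
    refine hT.tendsto_atTop_of_tendsto_mul (han.congr fun n => ?_)
    rw [map_measureReal_apply mX (measurableSet_exceed N _)]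
    rfl
  have hx : Tendsto (fun n => a n * u) atTop atTop := ha'.atTop_mul_const hu
  have hpos : ∀ n, 0 < a n * u := fun n => mul_pos (ha n) hu
  refine ⟨hpos, hx, hr.1, hr.2.1, fun ε hε hε1 δ hδ =>
    hT.eventually_far_le hx hε hε1 hpos ?_ hδ⟩
  -- The finite-cluster condition has a single level for both events; it is used at `ε * u`, the
  -- lower level in `IsClusterSeq.anti`.
  refine (hr.2.2.2 (ε * u) (by positivity)).congr fun m => ?_
  congr 1
  funext n
  have e : a n * (ε * u) = ε * (a n * u) := by ring
  have h0 : 0 ≤ ε * (a n * u) := (mul_pos hε (hpos n)).le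
  simp only [e, lt_maxNorm_iff N _ _ h0]
  rw [cond_map P mX (measurableSet_exceed N _)]
  exact (Measure.map_apply mX
    (IsTailPair.measurableSet_exists_lt N (farTimes m (r n) : Set ℤ) _)).symm

end

/-! ### The theorem: transfer from path space to the processes -/

theorem theorem2p5 {Ω Ω' : Type*} [MeasurableSpace Ω] [MeasurableSpace Ω'] {d : ℕ}
    (P : Measure Ω) [IsProbabilityMeasure P] (Q : Measure Ω') [IsProbabilityMeasure Q]
    (N : Seminorm ℝ (Vec d)) (hN : IsNorm N)
    (α : ℝ) (hα : 0 < α)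
    (X : ℤ → Ω → Vec d) (hXm : ∀ t, Measurable (X t))
    (hXs : IsStationaryProcess P X) (hXrv : IsJointlyRegularlyVarying P α X)
    (Y : ℤ → Ω' → Vec d) (hYm : ∀ t, Measurable (Y t)) (hY : IsTailProcess N α P X Q Y)
    (a : ℕ → ℝ) (ha : ∀ n, 0 < a n)
    (han : Tendsto (fun n : ℕ => (n : ℝ) * P.real {ω | a n < N (X 0 ω)}) atTop (𝓝 1))
    (r : ℕ → ℕ) (hr : FiniteCluster N P X a r) :
    -- the tail process vanishes at infinity (on `ℤ`, `cofinite` means `|t| → ∞`)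
    (∀ᵐ ω ∂Q, Tendsto (fun t : ℤ => N (Y t ω)) cofinite (𝓝 0)) ∧
    -- `θ` is the candidate extremal index
    (∀ k : ℕ, Tendsto
      (fun x : ℝ => (P[|{ω | x < N (X 0 ω)}]).real {ω | runMax N X k ω ≤ x})
      atTop (𝓝 (Q.real {ω | runMax N Y k ω ≤ 1}))) ∧
    Tendsto (fun k : ℕ => Q.real {ω | runMax N Y k ω ≤ 1}) atTop
      (𝓝 (candidateExtremalIndex N Q Y)) ∧
    -- `θ = Q(E) > 0`
    candidateExtremalIndex N Q Y = Q.real (firstMaxAtZero N Y) ∧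
    0 < Q.real (firstMaxAtZero N Y) ∧
    -- `∑_t δ_{Y_t}` is almost surely a point measure and defines a point process
    (∀ᵐ ω ∂Q, (tailPointProcess Y ω).toMeasure = atomSum fun t : ℤ => Y t ω) ∧
    AEMeasurable (tailPointProcess Y) Q ∧
    ∀ u : ℝ, 0 < u →
      -- the runs and blocks estimators
      Tendsto (fun n : ℕ =>
        (P[|{ω | a n * u < N (X 0 ω)}]).real {ω | runMax N X (r n) ω ≤ a n * u} -
          P.real {ω | a n * u < runMax N X (r n) ω} /
            ((r n : ℝ) * P.real {ω | a n * u < N (X 0 ω)})) atTop (𝓝 0) ∧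
      Tendsto (fun n : ℕ =>
        (P[|{ω | a n * u < N (X 0 ω)}]).real {ω | runMax N X (r n) ω ≤ a n * u})
        atTop (𝓝 (candidateExtremalIndex N Q Y)) ∧
      -- convergence in law of the cluster point process for the vague topology
      (∀ n, (∀ ω, (clusterProcess X (r n) (a n * u) ω).toMeasure =
        atomSum fun i : Set.Icc (1 : ℤ) (r n) => (a n * u)⁻¹ • X i ω) ∧
        Measurable (clusterProcess X (r n) (a n * u))) ∧
      WeakConv
        (fun n : ℕ => (P[|{ω | a n * u < runMax N X (r n) ω}]).map
          (clusterProcess X (r n) (a n * u)))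
        atTop
        ((Q[|firstMaxAtZero N Y]).map (tailPointProcess Y)) := by
  have mX : Measurable fun ω t => X t ω := measurable_pi_lambda _ hXm
  have mY : Measurable fun ω t => Y t ω := measurable_pi_lambda _ hYm
  have hT := hY.isTailPair hXm hXs hYm
  set ν : Measure (PathSpace d) := P.map fun ω t => X t ω
  set μ : Measure (PathSpace d) := Q.map fun ω t => Y t ω
  have hν := hT.prob_left
  have hμ := hT.prob_right
  have hC : ∀ u : ℝ, 0 < u → IsClusterSeq N ν (fun n => a n * u) r := fun u hu =>
    hr.isClusterSeq hXm ha han hT hu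
  have hνP : ∀ {A : Set (PathSpace d)}, MeasurableSet A →
      ν.real A = P.real {ω | (fun t => X t ω) ∈ A} := fun hA => map_measureReal_apply mX hA
  have hμQ : ∀ {A : Set (PathSpace d)}, MeasurableSet A →
      μ.real A = Q.real {ω | (fun t => Y t ω) ∈ A} := fun hA => map_measureReal_apply mY hA
  have mle : ∀ (k : ℕ) (x : ℝ), MeasurableSet
      {y : PathSpace d | ∀ t ∈ Finset.Icc 1 (k : ℤ), N (y t) ≤ x} := fun k x =>
    IsTailPair.measurableSet_forall_le N (Finset.Icc 1 (k : ℤ) : Finset ℤ) x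
  have mlt : ∀ (k : ℕ) (x : ℝ), MeasurableSet
      {y : PathSpace d | ∃ t ∈ Finset.Icc 1 (k : ℤ), x < N (y t)} := fun k x =>
    IsTailPair.measurableSet_exists_lt N (Finset.Icc 1 (k : ℤ) : Set ℤ) x
  have hruns : ∀ (k : ℕ) (x : ℝ), 0 ≤ x →
      (P[|{ω | x < N (X 0 ω)}]).real {ω | runMax N X k ω ≤ x} = ν.real (exceed N x ∩
        {y | ∀ t ∈ Finset.Icc 1 (k : ℤ), N (y t) ≤ x}) / ν.real (exceed N x) := by
    intro k x hx
    have hm : MeasurableSet {ω | x < N (X 0 ω)} := mX (measurableSet_exceed N x)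
    rw [real_cond_apply _ hm, hνP ((measurableSet_exceed N x).inter (mle k x)),
      hνP (measurableSet_exceed N x), div_eq_inv_mul]
    simp only [runMax, maxNorm_le_iff N _ _ hx]
    rfl
  have hrunY : ∀ k : ℕ, Q.real {ω | runMax N Y k ω ≤ 1}
      = μ.real {z | ∀ t ∈ Finset.Icc 1 (k : ℤ), N (z t) ≤ 1} := by
    intro k
    rw [hμQ (mle k 1)]
    simp only [runMax, maxNorm_le_iff N _ _ zero_le_one]
    rfl
  have hcand : candidateExtremalIndex N Q Y
      = μ.real {z | ∀ t ∈ Ici (1 : ℤ), N (z t) ≤ 1} := by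
    rw [hμQ (IsTailPair.measurableSet_forall_le N (Ici (1 : ℤ)) 1)]
    simp only [candidateExtremalIndex, supNorm_le_one_iff]
    rfl
  have hE : Q.real (firstMaxAtZero N Y) = μ.real (firstMaxPaths N) :=
    (hμQ (measurableSet_firstMaxPaths N)).symm
  -- The tail process does not depend on `u`, so any single level serves here.
  have hnorm := hT.ae_tendsto_norm (hC 1 one_pos)
  have anF := isAnchor_firstExceedance hnorm hT.ae_one_lt
  have anL := isAnchor_lastExceedance hnorm hT.ae_one_lt
  have anE := isAnchor_firstMaxPaths hnorm hT.ae_one_lt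
  have hnull : ∀ᵐ ω ∂Q, Tendsto (fun t => Y t ω) cofinite (𝓝 0) :=
    ae_of_ae_map mY.aemeasurable (hT.ae_tendsto hN (hC 1 one_pos))
  have htail : tailPointProcess Y =ᵐ[Q] fun ω => pathPointMeasure (toNullPath fun t => Y t ω) := by
    filter_upwards [hnull] with ω hω
    exact tailPointProcess_eq Y hω
  have htailm : Measurable fun ω => pathPointMeasure (toNullPath fun t => Y t ω) :=
    IsTailPair.measurable_pathPointMeasure_toNullPath.comp mY
  have hθ : candidateExtremalIndex N Q Y = Q.real (firstMaxAtZero N Y) := by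
    rw [hcand, hE]
    exact congrArg ENNReal.toReal (IsAnchor.measure_eq hT anL anE)
  refine ⟨ae_of_ae_map mY.aemeasurable hnorm, fun k => ?_, ?_, hθ, ?_, ?_,
    ⟨_, htailm, htail⟩, fun u hu => ?_⟩
  · rw [hrunY]
    refine (hT.conv_const (mle k 1) (hT.frontier_forall_le_null _ one_pos)).congr' ?_
    filter_upwards [eventually_gt_atTop 0] with x hx
    rw [hruns k x hx.le]
    simp only [Pi.smul_apply, seminorm_inv_smul N hx, div_le_one hx]
  · simp only [hrunY, hcand]
    exact IsTailPair.tendsto_real_forall_le μ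
  · rw [hE]
    exact ENNReal.toReal_pos (anE.measure_pos hT).ne' (measure_ne_top _ _)
  · filter_upwards [hnull] with ω hω
    exact tailPointProcess_toMeasure Y hω
  · have hpos : ∀ n, 0 < a n * u := (hC u hu).pos
    have mexc : ∀ n, {ω | a n * u < runMax N X (r n) ω} = (fun ω t => X t ω) ⁻¹'
        {y : PathSpace d | ∃ t ∈ Finset.Icc 1 (r n : ℤ), a n * u < N (y t)} := fun n => by
      ext ω
      simp only [runMax, lt_maxNorm_iff N _ _ (hpos n).le]
      rfl
    have lim1 : Tendsto (fun n : ℕ =>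
        (P[|{ω | a n * u < N (X 0 ω)}]).real {ω | runMax N X (r n) ω ≤ a n * u})
        atTop (𝓝 (candidateExtremalIndex N Q Y)) := by
      rw [hcand]
      exact (hT.tendsto_runs (hC u hu)).congr fun n => (hruns (r n) _ (hpos n).le).symm
    have lim2 : Tendsto (fun n : ℕ => P.real {ω | a n * u < runMax N X (r n) ω} /
        ((r n : ℝ) * P.real {ω | a n * u < N (X 0 ω)})) atTop
        (𝓝 (candidateExtremalIndex N Q Y)) := by
      -- The runs estimator leads to the last exceedance, the blocks estimator to the first;
      -- anchoring identifies the two limits.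
      rw [hcand, show μ.real {z | ∀ t ∈ Ici (1 : ℤ), N (z t) ≤ 1}
        = μ.real {z | ∀ t ∈ Iio (0 : ℤ), N (z t) ≤ 1} from
        congrArg ENNReal.toReal (IsAnchor.measure_eq hT anL anF)]
      refine (hT.tendsto_blocks hN (hC u hu)).congr fun n => ?_
      rw [hνP (mlt _ _), hνP (measurableSet_exceed N _), mexc]
      rfl
    have hclm : ∀ n, Measurable (clusterProcess X (r n) (a n * u)) := fun n => by
      have e : clusterProcess X (r n) (a n * u) = fun ω => pathPointMeasure
          (truncPath (Finset.Icc 1 (r n : ℤ)) ((a n * u)⁻¹ • fun t => X t ω)) :=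
        funext fun ω => clusterProcess_eq X _ _ ω
      rw [e]
      exact (continuous_pathPointMeasure.comp
        (continuous_truncPath_smul _ _)).measurable.comp mX
    refine ⟨by simpa using lim1.sub lim2, lim1,
      fun n => ⟨fun ω => clusterProcess_toMeasure X _ _ ω, hclm n⟩, fun F => ?_⟩
    have hFm : ∀ ρ : Measure (PointMeasure d), AEStronglyMeasurable F ρ := fun ρ =>
      F.continuous.measurable.aestronglyMeasurable
    -- The tail point process is given by the measurable map only `Q`-almost surely; absolute
    -- continuity carries this over to the conditional law.
    have habs : Q[|firstMaxAtZero N Y] ≪ Q := cond_absolutelyContinuous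
    have htail' := habs.ae_le htail
    have e1 : ∫ w, F w ∂((Q[|firstMaxAtZero N Y]).map (tailPointProcess Y))
        = (∫ z in firstMaxPaths N, F (pathPointMeasure (toNullPath z)) ∂μ) /
          μ.real (firstMaxPaths N) := by
      rw [Measure.map_congr htail', integral_map htailm.aemeasurable (hFm _), integral_cond, hE]
      have hmap := setIntegral_map (μ := Q)
        (f := fun z : PathSpace d => F (pathPointMeasure (toNullPath z)))
        (measurableSet_firstMaxPaths N) (F.continuous.measurable.comp
          IsTailPair.measurable_pathPointMeasure_toNullPath).aestronglyMeasurable mY.aemeasurable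
      exact congrArg (· / _) hmap.symm
    rw [e1]
    refine (hT.tendsto_cluster hN (hC u hu) F).congr fun n => ?_
    rw [integral_map (hclm n).aemeasurable (hFm _), integral_cond, mexc, hνP (mlt _ _)]
    simp only [clusterProcess_eq]
    refine congrArg (· / _) (setIntegral_map (mlt _ _) ?_ mX.aemeasurable)
    exact ((IsTailPair.continuous_comp_pathPointMeasure F).comp
      (continuous_truncPath_smul _ _)).measurable.aestronglyMeasurable
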